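/- A digraph is finite and simple: it has no loops and no multiple arcs, but opposite arcs $(u,v)$, $(v,u)$ are allowed. For a digraph $D$ with adjacency matrix $A$, a complementarity eigenvalue of $D$ is a real number $\lambda$ for which there is a nonzero vector $x\ge 0$ with $Ax\ge\lambda x$ and $\langle x,Ax-\lambda x\rangle=0$. The spectral radius $\rho(D)$ is the largest modulus of an eigenvalue of $A$. $\vec C_n$ ($n\ge 2$) denotes the directed cycle $1\to2\to\cdots\to n\to1$. Consider the following seven types of digraphs (up to isomorphism). - $\infty$-digraph $\infty(r,s)$, $r,s\ge2$: the cycles $1\to2\to\cdots\to r\to1$ and $1'\to2'\to\cdots\to s'\to1'$ with $1$ and $1'$ identified. - $\theta$-digraph $\theta(a,b,c)$, $0\le a\le b$, $b>0$, $c\ge0$: two directed paths from a vertex $u$ to a vertex $w\neq u$ with $a$ and $b$ inner vertices, and a directed path from $w$ to $u$ with $c$ inner vertices, all inner vertices being distinct and different from $u,w$. - Type 1: $\infty(r,s)$ with the additional arc $(r,2')$, $r,s\ge2$. - Type 2: $\infty(r,s)$ with the additional arcs $(r,2')$ and $(s',2)$, $r,s\ge2$. - Type 3: $\vec C_n$ with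 the additional arcs $(1,i)$ and $(i-1,j)$, where $2<i<j\le n$. - Type 4: $\vec C_n$ with $k\ge2$ additional arcs $(x_1,y_1),\dots,(x_k,y_k)$, where $1\le y_1<x_1<y_2<x_2<\cdots<y_k<x_k\le n$. - Type 5: $\vec C_n$ with the additional arcs $(1,i)$, $(i-1,j)$ and $(j-1,2)$, where $3<i<i+1<j\le n$. Let $D$ be a digraph with exactly three complementarity eigenvalues. Then every strongly connected component of $D$ (as an induced subdigraph) is an isolated vertex, a directed cycle, or a digraph of one of the seven types. At least one strongly connected component is of one of the seven types, and any two strongly connected components that are of one of the seven types have the same spectral radius. -/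

import Mathlib

/-- The complementarity eigenvalues of a real square matrix `A`: the reals `μ` for which there is a
nonzero vector `x ≥ 0` with `A x ≥ μ x` and `⟨x, A x - μ x⟩ = 0`. -/
def Matrix.complementaritySpectrum {ι : Type*} [Fintype ι] (A : Matrix ι ι ℝ) : Set ℝ :=
  {μ | ∃ x : ι → ℝ, x ≠ 0 ∧ 0 ≤ x ∧ μ • x ≤ A.mulVec x ∧ x ⬝ᵥ (A.mulVec x - μ • x) = 0}

namespace Digraph

variable {V : Type*}

open Classical in
/-- The adjacency matrix: entry `1` at `(u, v)` if there is an arc from `u` to `v`, else `0`. -/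
noncomputable def adjMatrix (R : Type*) [Zero R] [One R] (D : Digraph V) : Matrix V V R :=
  Matrix.of fun u v => if D.Adj u v then 1 else 0

/-- The complementarity spectrum of a finite digraph. -/
noncomputable def complementaritySpectrum [Finite V] (D : Digraph V) : Set ℝ :=
  letI := Fintype.ofFinite V
  (D.adjMatrix ℝ).complementaritySpectrum

open Classical in
/-- The spectral radius of a finite digraph: the largest modulus of a complex eigenvalue of its
adjacency matrix. -/
noncomputable def specRadius [Finite V] (D : Digraph V) : ENNReal :=
  letI := Fintype.ofFinite V
  spectralRadius ℂ (D.adjMatrix ℂ)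

/-- The subdigraph of `D` induced by a set of vertices. -/
def induced (D : Digraph V) (S : Set V) : Digraph S where
  Adj u v := D.Adj u v

/-- The vertex set of the strongly connected component of `v`: the vertices `w` such that there are
directed walks (possibly of length zero) from `v` to `w` and from `w` to `v`. -/
def strongComponent (D : Digraph V) (v : V) : Set V :=
  {w | Relation.ReflTransGen D.Adj v w ∧ Relation.ReflTransGen D.Adj w v}

/-- The vertex sets of the strongly connected components of `D`. -/
def strongComponents (D : Digraph V) : Set (Set V) :=
  Set.range D.strongComponent

/-- `D` is isomorphic to the digraph with vertices `1, …, n` and arcs given by the relation `R`. -/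
def IsoTo (D : Digraph V) (n : ℕ) (R : ℕ → ℕ → Prop) : Prop :=
  ∃ e : V ≃ Set.Icc 1 n, ∀ u v, D.Adj u v ↔ R (e u) (e v)

/-- Arcs of the cycle `1 → 2 → ⋯ → n → 1`, on vertices `1, …, n`. -/
def CycleArc (n x y : ℕ) : Prop :=
  y = x + 1 ∨ (x = n ∧ y = 1)

/-- Arcs of the directed path `s → o + 1 → o + 2 → ⋯ → o + k → t` with `k` inner vertices
(the single arc `s → t` if `k = 0`). -/
def PathArc (s t o k x y : ℕ) : Prop :=
  (k = 0 ∧ x = s ∧ y = t) ∨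
  (0 < k ∧ ((x = s ∧ y = o + 1) ∨ (o + 1 ≤ x ∧ x < o + k ∧ y = x + 1) ∨ (x = o + k ∧ y = t)))

/-- Arcs of the coalescence of the cycle `1 → 2 → ⋯ → r → 1` and the cycle
`1' → 2' → ⋯ → s' → 1'` at the vertex `1 = 1'`. The vertex `j'` with `2 ≤ j ≤ s` carries the
number `r + j - 1`; so `2'` is `r + 1` and `s'` is `r + s - 1`. -/
def InftyArc (r s x y : ℕ) : Prop :=
  PathArc 1 1 1 (r - 1) x y ∨ PathArc 1 1 r (s - 1) x y

/-- Arcs of `θ(a, b, c)`: two directed paths from vertex `1` to vertex `2`, with `a` and `b` inner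
vertices, and a directed path from `2` to `1` with `c` inner vertices, all inner vertices
distinct. -/
def ThetaArc (a b c x y : ℕ) : Prop :=
  PathArc 1 2 2 a x y ∨ PathArc 1 2 (2 + a) b x y ∨ PathArc 2 1 (2 + a + b) c x y

/-- A single vertex without arcs. -/
def IsIsolatedVertex (D : Digraph V) : Prop :=
  D.IsoTo 1 fun _ _ => False

/-- A directed cycle; `n = 2` gives a pair of opposite arcs. -/
def IsCycle (D : Digraph V) : Prop :=
  ∃ n, 2 ≤ n ∧ D.IsoTo n (CycleArc n)

/-- An `∞`-digraph `∞(r, s)`. -/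
def IsInfty (D : Digraph V) : Prop :=
  ∃ r s, 2 ≤ r ∧ 2 ≤ s ∧ D.IsoTo (r + s - 1) (InftyArc r s)

/-- A `θ`-digraph `θ(a, b, c)`. -/
def IsTheta (D : Digraph V) : Prop :=
  ∃ a b c, a ≤ b ∧ 0 < b ∧ D.IsoTo (a + b + c + 2) (ThetaArc a b c)

/-- Type 1: `∞(r, s)` with the additional arc `(r, 2')`. -/
def IsType1 (D : Digraph V) : Prop :=
  ∃ r s, 2 ≤ r ∧ 2 ≤ s ∧ D.IsoTo (r + s - 1) fun x y =>
    InftyArc r s x y ∨ (x = r ∧ y = r + 1)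

/-- Type 2: `∞(r, s)` with the additional arcs `(r, 2')` and `(s', 2)`. -/
def IsType2 (D : Digraph V) : Prop :=
  ∃ r s, 2 ≤ r ∧ 2 ≤ s ∧ D.IsoTo (r + s - 1) fun x y =>
    InftyArc r s x y ∨ (x = r ∧ y = r + 1) ∨ (x = r + s - 1 ∧ y = 2)

/-- Type 3: the cycle on `1, …, n` with the additional arcs `(1, i)` and `(i - 1, j)`, where
`2 < i < j ≤ n`. -/
def IsType3 (D : Digraph V) : Prop :=
  ∃ n i j, 2 < i ∧ i < j ∧ j ≤ n ∧ D.IsoTo n fun x y =>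
    CycleArc n x y ∨ (x = 1 ∧ y = i) ∨ (x = i - 1 ∧ y = j)

/-- Type 4: the cycle on `1, …, n` with `k ≥ 2` additional arcs `(a i, b i)`, where
`1 ≤ b i < a i ≤ n` and the intervals `[b i, a i]` are pairwise disjoint and listed in increasing
order. -/
def IsType4 (D : Digraph V) : Prop :=
  ∃ (n k : ℕ) (a b : Fin k → ℕ), 2 ≤ k ∧
    (∀ i, 1 ≤ b i ∧ b i < a i ∧ a i ≤ n) ∧ (∀ i j, i < j → a i < b j) ∧
    D.IsoTo n fun x y => CycleArc n x y ∨ ∃ i, x = a i ∧ y = b i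

/-- Type 5: the cycle on `1, …, n` with the additional arcs `(1, i)`, `(i - 1, j)` and
`(j - 1, 2)`, where `3 < i < i + 1 < j ≤ n`. -/
def IsType5 (D : Digraph V) : Prop :=
  ∃ n i j, 3 < i ∧ i + 1 < j ∧ j ≤ n ∧ D.IsoTo n fun x y =>
    CycleArc n x y ∨ (x = 1 ∧ y = i) ∨ (x = i - 1 ∧ y = j) ∨ (x = j - 1 ∧ y = 2)

/-- `D` is of one of the seven types. -/
def IsOneOfSevenTypes (D : Digraph V) : Prop :=
  D.IsInfty ∨ D.IsTheta ∨ D.IsType1 ∨ D.IsType2 ∨ D.IsType3 ∨ D.IsType4 ∨ D.IsType5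

end Digraph

/-! Since the adjacency matrix is nonnegative, a complementarity eigenvector is just a nonnegative
vector that is an eigenvector on its own support; off the support the inequality is automatic. Hence
every nonempty strongly connected vertex set contributes its Perron value
(`IsStrongOn.exists_isPerronPair`), and this value strictly decreases on passing to a proper
nonempty subset that also carries a Perron vector (`IsPerronPair.lt_of_ssubset`). Single vertices
give `0`, induced cycles give `1`, and a strongly connected set that is neither has value greater
than `1`.

With exactly three eigenvalues the spectrum is therefore `{0, 1, μ}`, where `μ` is the value of
every such set. So these sets share one spectral radius and none properly contains another. They do
occur, since otherwise the spectrum would lie in `{0, 1}`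
(`complementaritySpectrum_subset_of_functional`).

What remains is combinatorial: to describe a strongly connected digraph whose proper strongly
connected induced subdigraphs are all vertices or cycles. It is an induced cycle with one shortest
ear (`exists_isEarEnumeration`). Whenever the ear and a segment of the cycle form a closed walk
missing a vertex, the induced subdigraph must be a bare cycle (`functional_of_arc`). This leaves at
most two entries to the ear and two exits, in prescribed positions, and allows back arcs inside the
ear only in one configuration, which yields type 4. Explicit renumberings identify the other cases.
-/

/-! ### Perron–Frobenius theory for irreducible nonnegative matrices -/

namespace Matrix

variable {ι : Type*} [Fintype ι] [DecidableEq ι]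

theorem exists_pow_pos_of_reflTransGen {A : Matrix ι ι ℝ} (hA : ∀ i j, 0 ≤ A i j) {i j : ι}
    (h : Relation.ReflTransGen (fun a b => 0 < A a b) i j) : ∃ k : ℕ, 0 < (A ^ k) i j := by
  induction h with
  | refl => exact ⟨0, by simp⟩
  | @tail b c _ hbc ih =>
    obtain ⟨k, hk⟩ := ih
    refine ⟨k + 1, ?_⟩
    rw [pow_succ, Matrix.mul_apply]
    exact Finset.sum_pos' (fun d _ => mul_nonneg (pow_apply_nonneg hA k i d) (hA d c))
      ⟨b, Finset.mem_univ _, mul_pos hk hbc⟩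

/-- A sum of powers of `A`, long enough to include a connecting walk for every pair, is positive and
commutes with `A`. It will turn weak inequalities between `A x` and `t x` into strict ones. -/
theorem exists_pos_commute {A : Matrix ι ι ℝ} (hA : ∀ i j, 0 ≤ A i j)
    (hirr : ∀ i j, Relation.ReflTransGen (fun a b => 0 < A a b) i j) :
    ∃ B : Matrix ι ι ℝ, A * B = B * A ∧ ∀ i j, 0 < B i j := by
  choose k hk using fun i j => exists_pow_pos_of_reflTransGen hA (hirr i j)
  let N := Finset.univ.sup fun p : ι × ι => k p.1 p.2
  refine ⟨∑ l ∈ Finset.range (N + 1), A ^ l, ?_, fun i j => ?_⟩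
  · rw [Finset.mul_sum, Finset.sum_mul]
    exact Finset.sum_congr rfl fun l _ => (pow_succ' A l).symm.trans (pow_succ A l)
  · rw [Matrix.sum_apply]
    refine Finset.sum_pos' (fun l _ => pow_apply_nonneg hA l i j) ⟨k i j, ?_, hk i j⟩
    rw [Finset.mem_range, Nat.lt_succ_iff]
    exact Finset.le_sup (f := fun p : ι × ι => k p.1 p.2) (Finset.mem_univ (i, j))

/-- Existence of a Perron vector of an irreducible nonnegative matrix. -/
theorem exists_pos_eigenvector [Nonempty ι] {A : Matrix ι ι ℝ} (hA : ∀ i j, 0 ≤ A i j)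
    (hirr : ∀ i j, Relation.ReflTransGen (fun a b => 0 < A a b) i j) :
    ∃ (μ : ℝ) (x : ι → ℝ), (∀ i, 0 < x i) ∧ ∀ i, (A *ᵥ x) i = μ * x i := by
  obtain ⟨B, hAB, hB⟩ := exists_pos_commute hA hirr
  set M : ℝ := ∑ i, ∑ j, A i j with hM
  have hbound : ∀ (t : ℝ) (x : ι → ℝ), x ∈ stdSimplex ℝ ι → (∀ i, t * x i ≤ (A *ᵥ x) i) →
      t ≤ M := by
    intro t x hx h
    calc t = ∑ i, t * x i := by rw [← Finset.mul_sum, hx.2, mul_one]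
      _ ≤ ∑ i, (A *ᵥ x) i := Finset.sum_le_sum fun i _ => h i
      _ ≤ M := by
        refine Finset.sum_le_sum fun i _ => Finset.sum_le_sum fun j _ => ?_
        have hj : x j ≤ 1 := by
          rw [← hx.2]; exact Finset.single_le_sum (fun l _ => hx.1 l) (Finset.mem_univ j)
        exact mul_le_of_le_one_right (hA i j) hj
  -- Collatz–Wielandt: the Perron value is the largest `t` with `t x ≤ A x` for some `x` in the
  -- simplex. The bound `M` makes the set of such pairs compact.
  let K : Set (ℝ × (ι → ℝ)) :=
    (Set.Icc 0 M ×ˢ stdSimplex ℝ ι) ∩ {p | ∀ i, p.1 * p.2 i ≤ (A *ᵥ p.2) i}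
  have hmv : Continuous fun p : ℝ × (ι → ℝ) => A *ᵥ p.2 :=
    Continuous.matrix_mulVec continuous_const continuous_snd
  have hK : IsCompact K := by
    refine (isCompact_Icc.prod (isCompact_stdSimplex ℝ ι)).inter_right ?_
    rw [Set.ofPred_forall]
    refine isClosed_iInter fun i => isClosed_le ?_ ?_
    · exact continuous_fst.mul ((continuous_apply i).comp continuous_snd)
    · exact (continuous_apply i).comp hmv
  have hM0 : 0 ≤ M := Finset.sum_nonneg fun i _ => Finset.sum_nonneg fun j _ => hA i j
  have hKne : K.Nonempty := by
    obtain ⟨i0⟩ := ‹Nonempty ι›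
    refine ⟨(0, Pi.single i0 1), ⟨⟨le_refl 0, hM0⟩, single_mem_stdSimplex ℝ i0⟩, fun i => ?_⟩
    simpa using hA i i0
  obtain ⟨⟨t, x⟩, ⟨⟨ht, hx⟩, htx⟩, hmax⟩ := hK.exists_isMaxOn hKne continuous_fst.continuousOn
  have htx : ∀ i, t * x i ≤ (A *ᵥ x) i := htx
  have hx : x ∈ stdSimplex ℝ ι := hx
  have ht : t ∈ Set.Icc 0 M := ht
  have hmax : ∀ p ∈ K, p.1 ≤ t := hmax
  have hBpos : ∀ z : ι → ℝ, (∀ i, 0 ≤ z i) → (∃ i, 0 < z i) → ∀ i, 0 < (B *ᵥ z) i := by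
    rintro z hz ⟨j, hj⟩ i
    exact Finset.sum_pos' (fun l _ => mul_nonneg (hB i l).le (hz l))
      ⟨j, Finset.mem_univ _, mul_pos (hB i j) hj⟩
  have hxpos : ∃ i, 0 < x i := by
    by_contra! h
    have : ∑ i, x i ≤ 0 := Finset.sum_nonpos fun i _ => h i
    rw [hx.2] at this
    linarith
  -- If `A x ≠ t x`, then `y = B x` satisfies `t y < A y` in every coordinate, so `t` can be raised
  -- by the least relative gap `e`, against maximality.
  have heig : ∀ i, (A *ᵥ x) i = t * x i := by
    by_contra! hne
    obtain ⟨i1, hi1⟩ := hne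
    have hz : ∀ i, 0 < (B *ᵥ (A *ᵥ x - t • x)) i := by
      refine hBpos _ (fun i => ?_) ⟨i1, ?_⟩
      · simpa using htx i
      · have := lt_of_le_of_ne (htx i1) (Ne.symm hi1)
        simpa using this
    set y := B *ᵥ x with hy
    have hyeq : B *ᵥ (A *ᵥ x - t • x) = A *ᵥ y - t • y := by
      rw [hy, Matrix.mulVec_sub, Matrix.mulVec_smul, Matrix.mulVec_mulVec, Matrix.mulVec_mulVec,
        hAB]
    have hypos : ∀ i, 0 < y i := hBpos x hx.1 hxpos
    rw [hyeq] at hz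
    have hz' : ∀ i, t * y i < (A *ᵥ y) i := fun i => by simpa using hz i
    obtain ⟨i2, -, hi2⟩ := Finset.exists_min_image Finset.univ
      (fun i => ((A *ᵥ y) i - t * y i) / y i) Finset.univ_nonempty
    set e := ((A *ᵥ y) i2 - t * y i2) / y i2 with he
    have hepos : 0 < e := div_pos (by linarith [hz' i2]) (hypos i2)
    have hey : ∀ i, (t + e) * y i ≤ (A *ᵥ y) i := by
      intro i
      have := hi2 i (Finset.mem_univ i)
      rw [le_div_iff₀ (hypos i)] at this
      linarith
    set s := ∑ i, y i with hs
    have hspos : 0 < s := Finset.sum_pos (fun i _ => hypos i) Finset.univ_nonempty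
    have hsimp : s⁻¹ • y ∈ stdSimplex ℝ ι := by
      refine ⟨fun i => mul_nonneg (inv_nonneg.2 hspos.le) (hypos i).le, ?_⟩
      simp only [Pi.smul_apply, smul_eq_mul]
      rw [← Finset.mul_sum, ← hs, inv_mul_cancel₀ hspos.ne']
    have hle : ∀ i, (t + e) * (s⁻¹ • y) i ≤ (A *ᵥ (s⁻¹ • y)) i := by
      intro i
      rw [Matrix.mulVec_smul, Pi.smul_apply, Pi.smul_apply, smul_eq_mul, smul_eq_mul,
        mul_left_comm]
      exact mul_le_mul_of_nonneg_left (hey i) (inv_nonneg.2 hspos.le)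
    have := hmax (t + e, s⁻¹ • y)
      ⟨⟨⟨by linarith [ht.1], hbound _ _ hsimp hle⟩, hsimp⟩, hle⟩
    simp only at this
    linarith
  refine ⟨t, x, fun i => ?_, heig⟩
  by_contra hi
  have hi0 : x i = 0 := le_antisymm (not_lt.1 hi) (hx.1 i)
  obtain ⟨j, hj⟩ := hxpos
  -- A zero of `x` spreads along arcs: the terms of `(A x) b = t * x b = 0` are nonnegative, so each
  -- vanishes.
  have hall : ∀ k, Relation.ReflTransGen (fun a b => 0 < A a b) i k → x k = 0 := by
    intro k hk
    induction hk with
    | refl => exact hi0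
    | @tail b c _ hbc ih =>
      have h1 : ∑ l, A b l * x l = 0 := (heig b).trans (by rw [ih, mul_zero])
      have h2 := (Finset.sum_eq_zero_iff_of_nonneg
        (fun l _ => mul_nonneg (hA b l) (hx.1 l))).1 h1 c (Finset.mem_univ c)
      exact (mul_eq_zero.1 h2).resolve_left hbc.ne'
  exact hj.ne' (hall j (hirr i j))

/-- A positive eigenvector of a nonnegative matrix belongs to its spectral radius. -/
theorem spectralRadius_eq_of_pos_eigenvector [Nonempty ι] {A : Matrix ι ι ℝ}
    (hA : ∀ i j, 0 ≤ A i j) {μ : ℝ} {x : ι → ℝ} (hx : ∀ i, 0 < x i)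
    (h : ∀ i, (A *ᵥ x) i = μ * x i) :
    spectralRadius ℂ (A.map (Complex.ofReal)) = ENNReal.ofReal μ := by
  have hmem : ∀ k : ℂ, k ∈ spectrum ℂ (A.map Complex.ofReal) ↔
      ∃ z : ι → ℂ, z ≠ 0 ∧ A.map Complex.ofReal *ᵥ z = k • z := by
    intro k
    rw [← Matrix.spectrum_toLin', ← Module.End.hasEigenvalue_iff_mem_spectrum]
    constructor
    · intro hk
      obtain ⟨z, hz⟩ := hk.exists_hasEigenvector
      exact ⟨z, hz.2, by simpa using hz.apply_eq_smul⟩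
    · rintro ⟨z, hz, hzk⟩
      refine Module.End.hasEigenvalue_of_hasEigenvector (x := z) ⟨?_, hz⟩
      rw [Module.End.mem_eigenspace_iff]
      simpa using hzk
  have hμ : 0 ≤ μ := by
    obtain ⟨i⟩ := ‹Nonempty ι›
    have h0 : 0 ≤ (A *ᵥ x) i := Finset.sum_nonneg fun j _ => mul_nonneg (hA i j) (hx j).le
    rw [h i] at h0
    exact nonneg_of_mul_nonneg_left h0 (hx i)
  apply le_antisymm
  · refine iSup₂_le fun k hk => ?_
    obtain ⟨z, hz, hzk⟩ := (hmem k).1 hk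
    -- At an index where `‖z i‖ / x i` is largest, the triangle inequality compares any eigenvalue
    -- with `μ`.
    obtain ⟨i, -, hi⟩ := Finset.exists_max_image Finset.univ (fun i => ‖z i‖ / x i)
      Finset.univ_nonempty
    set c := ‖z i‖ / x i with hc
    have hzc : ∀ j, ‖z j‖ ≤ c * x j := fun j => (div_le_iff₀ (hx j)).1 (hi j (Finset.mem_univ j))
    have hzi : ‖z i‖ = c * x i := by rw [hc, div_mul_cancel₀ _ (hx i).ne']
    have hcpos : 0 < ‖z i‖ := by
      by_contra hn
      apply hz
      funext j
      have hc0 : c = 0 := by rw [hc, le_antisymm (not_lt.1 hn) (norm_nonneg _), zero_div]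
      have := hzc j
      rw [hc0, zero_mul] at this
      simpa using this
    have hkz : ‖k‖ * ‖z i‖ ≤ μ * ‖z i‖ := by
      calc ‖k‖ * ‖z i‖ = ‖(A.map Complex.ofReal *ᵥ z) i‖ := by
            rw [hzk, Pi.smul_apply, smul_eq_mul, norm_mul]
        _ ≤ ∑ j, ‖A.map Complex.ofReal i j * z j‖ := norm_sum_le _ _
        _ ≤ ∑ j, c * (A i j * x j) := by
            refine Finset.sum_le_sum fun j _ => ?_
            rw [norm_mul, Matrix.map_apply, Complex.norm_real, Real.norm_of_nonneg (hA i j),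
              mul_left_comm]
            exact mul_le_mul_of_nonneg_left (hzc j) (hA i j)
        _ = c * (A *ᵥ x) i := by rw [← Finset.mul_sum]; rfl
        _ = μ * ‖z i‖ := by rw [h i, hzi]; ring
    have hk' : ‖k‖ ≤ μ := le_of_mul_le_mul_right hkz hcpos
    rw [← ENNReal.ofReal_coe_nnreal]
    exact ENNReal.ofReal_le_ofReal hk'
  · have : (μ : ℂ) ∈ spectrum ℂ (A.map Complex.ofReal) := by
      refine (hmem _).2 ⟨fun i => (x i : ℂ), ?_, ?_⟩
      · obtain ⟨i⟩ := ‹Nonempty ι›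
        intro h0
        exact (hx i).ne' (by simpa using congrFun h0 i)
      · funext i
        have := congrArg Complex.ofReal (h i)
        simpa [Matrix.mulVec, dotProduct] using this
    refine le_trans (le_of_eq ?_) (le_iSup₂ (f := fun k (_ : k ∈ spectrum ℂ _) =>
      (‖k‖₊ : ENNReal)) (μ : ℂ) this)
    rw [← ENNReal.ofReal_coe_nnreal]
    simp [abs_of_nonneg hμ]

end Matrix

/-! ### Strongly connected vertex sets and induced cycles -/

namespace Digraph

open Relation

variable {V : Type*}

theorem reflTransGen_map {α β : Type*} {r : α → α → Prop} {p : β → β → Prop} (f : α → β)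
    (h : ∀ a b, r a b → p (f a) (f b)) {a b : α} (hab : ReflTransGen r a b) :
    ReflTransGen p (f a) (f b) := by
  induction hab with
  | refl => exact ReflTransGen.refl
  | tail _ hbc ih => exact ih.tail (h _ _ hbc)

/-- The subdigraph induced by `S` is strongly connected. -/
def IsStrongOn (D : Digraph V) (S : Set V) : Prop :=
  ∀ u ∈ S, ∀ v ∈ S, ReflTransGen (fun a b => D.Adj a b ∧ b ∈ S) u v

/-- In the subdigraph induced by `S` every vertex has at most one out-neighbour. -/
def IsFunctionalOn (D : Digraph V) (S : Set V) : Prop :=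
  ∀ x ∈ S, ∀ y ∈ S, ∀ z ∈ S, D.Adj x y → D.Adj x z → y = z

theorem IsFunctionalOn.mono {D : Digraph V} {S T : Set V} (hS : D.IsFunctionalOn S)
    (h : T ⊆ S) : D.IsFunctionalOn T :=
  fun x hx y hy z hz => hS x (h hx) y (h hy) z (h hz)

theorem mem_of_reflTransGen {D : Digraph V} {S : Set V} {u v : V} (hu : u ∈ S)
    (h : ReflTransGen (fun a b => D.Adj a b ∧ b ∈ S) u v) : v ∈ S := by
  induction h with
  | refl => exact hu
  | tail _ hbc _ => exact hbc.2

/-- A property of the vertices of `S` that passes to out-neighbours in `S` and holds somewhere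
holds everywhere, if `S` is strongly connected. -/
theorem IsStrongOn.forall_of_closed {D : Digraph V} {S : Set V} (hS : D.IsStrongOn S)
    {p : V → Prop} {u : V} (hu : u ∈ S) (hp : p u)
    (hstep : ∀ a ∈ S, p a → ∀ b ∈ S, D.Adj a b → p b) : ∀ v ∈ S, p v := by
  intro v hv
  have key : ∀ w, ReflTransGen (fun a b => D.Adj a b ∧ b ∈ S) u w → w ∈ S ∧ p w := by
    intro w hw
    induction hw with
    | refl => exact ⟨hu, hp⟩
    | tail _ hbc ih => exact ⟨hbc.2, hstep _ ih.1 ih.2 _ hbc.2 hbc.1⟩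
  exact (key v (hS u hu v hv)).2

theorem IsStrongOn.exists_adj {D : Digraph V} {S : Set V} (hS : D.IsStrongOn S)
    (hnt : S.Nontrivial) {u : V} (hu : u ∈ S) : ∃ v ∈ S, D.Adj u v := by
  obtain ⟨v, hv, hvu⟩ := hnt.exists_ne u
  rcases (hS u hu v hv).cases_head with h | ⟨c, hc, -⟩
  · exact absurd h.symm hvu
  · exact ⟨c, hc.2, hc.1⟩

theorem IsStrongOn.union {D : Digraph V} {S T : Set V} (hS : D.IsStrongOn S)
    (hT : D.IsStrongOn T) {w : V} (hwS : w ∈ S) (hwT : w ∈ T) : D.IsStrongOn (S ∪ T) := by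
  have hS' : ∀ u ∈ S, ∀ v ∈ S, ReflTransGen (fun a b => D.Adj a b ∧ b ∈ S ∪ T) u v :=
    fun u hu v hv => reflTransGen_map id (fun a b h => ⟨h.1, Or.inl h.2⟩) (hS u hu v hv)
  have hT' : ∀ u ∈ T, ∀ v ∈ T, ReflTransGen (fun a b => D.Adj a b ∧ b ∈ S ∪ T) u v :=
    fun u hu v hv => reflTransGen_map id (fun a b h => ⟨h.1, Or.inr h.2⟩) (hT u hu v hv)
  intro u hu v hv
  have h1 : ReflTransGen (fun a b => D.Adj a b ∧ b ∈ S ∪ T) u w :=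
    hu.elim (fun h => hS' u h w hwS) (fun h => hT' u h w hwT)
  have h2 : ReflTransGen (fun a b => D.Adj a b ∧ b ∈ S ∪ T) w v :=
    hv.elim (fun h => hS' w hwS v h) (fun h => hT' w hwT v h)
  exact h1.trans h2

/-- A walk between `v` and a vertex of its component never leaves the component, because each
intermediate vertex also reaches, and is reached from, `v`. -/
theorem isStrongOn_strongComponent (D : Digraph V) (v : V) :
    D.IsStrongOn (D.strongComponent v) := by
  have hto : ∀ w, ReflTransGen D.Adj v w → ReflTransGen D.Adj w v →
      ReflTransGen (fun a b => D.Adj a b ∧ b ∈ D.strongComponent v) v w := by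
    intro w h
    induction h with
    | refl => exact fun _ => ReflTransGen.refl
    | @tail b c hvb hbc ih =>
      intro hcv
      exact (ih (hcv.head hbc)).tail ⟨hbc, hvb.tail hbc, hcv⟩
  have hfrom : ∀ w, ReflTransGen D.Adj w v → ReflTransGen D.Adj v w →
      ReflTransGen (fun a b => D.Adj a b ∧ b ∈ D.strongComponent v) w v := by
    intro w h
    induction h using ReflTransGen.head_induction_on with
    | refl => exact fun _ => ReflTransGen.refl
    | @head a c hac hcv ih =>
      intro hva
      exact (ih (hva.tail hac)).head ⟨hac, hva.tail hac, hcv⟩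
  exact fun a ha b hb => (hfrom a ha.2 ha.1).trans (hto b hb.1 hb.2)

theorem mem_strongComponent_self (D : Digraph V) (v : V) : v ∈ D.strongComponent v :=
  ⟨ReflTransGen.refl, ReflTransGen.refl⟩

theorem IsStrongOn.subset_strongComponent {D : Digraph V} {S : Set V} (hS : D.IsStrongOn S)
    {v : V} (hv : v ∈ S) : S ⊆ D.strongComponent v := fun w hw =>
  ⟨reflTransGen_map id (fun _ _ h => h.1) (hS v hv w hw),
    reflTransGen_map id (fun _ _ h => h.1) (hS w hw v hv)⟩

theorem IsStrongOn.image_induced {D : Digraph V} {S : Set V} {T : Set S}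
    (hT : (D.induced S).IsStrongOn T) : D.IsStrongOn (Subtype.val '' T) := by
  rintro _ ⟨u, hu, rfl⟩ _ ⟨v, hv, rfl⟩
  exact reflTransGen_map Subtype.val (fun a b h => ⟨h.1, b, h.2, rfl⟩) (hT u hu v hv)

theorem IsStrongOn.induced_univ {D : Digraph V} {S : Set V} (hS : D.IsStrongOn S) :
    (D.induced S).IsStrongOn Set.univ := by
  rintro ⟨u, hu⟩ - ⟨v, hv⟩ -
  have key : ∀ w, ReflTransGen (fun a b => D.Adj a b ∧ b ∈ S) u w → ∀ hw : w ∈ S,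
      ReflTransGen (fun a b => (D.induced S).Adj a b ∧ b ∈ Set.univ) ⟨u, hu⟩ ⟨w, hw⟩ := by
    intro w h
    induction h with
    | refl => exact fun _ => ReflTransGen.refl
    | @tail b c hub hbc ih =>
      intro hw
      exact (ih (mem_of_reflTransGen hu hub)).tail ⟨hbc.1, trivial⟩
  exact key v (hS u hu v hv) hv

/-- If every vertex of the finite set `S` has an out-neighbour in `S`, then `S` contains the vertex
set of an induced directed cycle. -/
theorem exists_strong_functional [Finite V] {D : Digraph V} {S : Set V} (hne : S.Nonempty)
    (hS : ∀ u ∈ S, ∃ v ∈ S, D.Adj u v) :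
    ∃ T ⊆ S, T.Nonempty ∧ D.IsStrongOn T ∧ D.IsFunctionalOn T ∧ ∀ u ∈ T, ∃ v ∈ T, D.Adj u v := by
  obtain ⟨T, hTS, hT⟩ := exists_minimal_le_of_wellFoundedLT
    (fun T : Set V => T.Nonempty ∧ ∀ u ∈ T, ∃ v ∈ T, D.Adj u v) S ⟨hne, hS⟩
  obtain ⟨⟨hTne, hTadj⟩, hmin⟩ := hT
  have hmin' : ∀ R ⊆ T, R.Nonempty → (∀ u ∈ R, ∃ v ∈ R, D.Adj u v) → T ⊆ R :=
    fun R hR h1 h2 => hmin ⟨h1, h2⟩ hR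
  refine ⟨T, hTS, hTne, ?_, ?_, hTadj⟩
  · intro u hu v hv
    -- The set reachable from `u` inside `T` again has out-neighbours within itself, so minimality
    -- makes it all of `T`.
    let R := {w | ReflTransGen (fun a b => D.Adj a b ∧ b ∈ T) u w}
    have hRT : R ⊆ T := fun w hw => mem_of_reflTransGen hu hw
    refine hmin' R hRT ⟨u, ReflTransGen.refl⟩ (fun w hw => ?_) hv
    obtain ⟨w', hw', hww'⟩ := hTadj w (hRT hw)
    exact ⟨w', ReflTransGen.tail hw ⟨hww', hw'⟩, hww'⟩
  · intro x hx y hy z hz hxy hxz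
    by_contra hyz
    choose! s hs using hTadj
    -- The image of a successor function `f` has out-neighbours within itself, so by minimality `f`
    -- is onto, hence bijective. Two successor functions that differ only at `x` cannot both be
    -- bijective.
    have hinj : ∀ f : T → T, (∀ a : T, D.Adj a (f a)) → Function.Bijective f := by
      intro f hf
      apply Function.Surjective.bijective_of_finite
      intro b
      have hsub := hmin' (Subtype.val '' Set.range f)
        (by rintro _ ⟨a, -, rfl⟩; exact a.2)
        ⟨f ⟨x, hx⟩, f ⟨x, hx⟩, ⟨_, rfl⟩, rfl⟩
        (by rintro _ ⟨a, -, rfl⟩; exact ⟨f a, ⟨f a, ⟨a, rfl⟩, rfl⟩, hf a⟩)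
      obtain ⟨b', hb', hbb⟩ := hsub b.2
      rwa [Subtype.ext hbb] at hb'
    classical
    let s0 : T → T := fun a => ⟨s a, (hs a a.2).1⟩
    have hupd : ∀ w : T, D.Adj x w → ∀ a : T, D.Adj a (Function.update s0 ⟨x, hx⟩ w a) := by
      intro w hw a
      by_cases h : a = ⟨x, hx⟩
      · subst h; simpa using hw
      · rw [Function.update_of_ne h]; exact (hs a a.2).2
    have h1 := hinj _ (hupd ⟨y, hy⟩ hxy)
    have h2 := hinj _ (hupd ⟨z, hz⟩ hxz)
    obtain ⟨w, hw⟩ := h1.2 ⟨z, hz⟩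
    have hwx : w ≠ ⟨x, hx⟩ := by
      rintro rfl
      simp only [Function.update_self, Subtype.mk.injEq] at hw
      exact hyz hw
    rw [Function.update_of_ne hwx] at hw
    exact hwx (h2.1 (by rw [Function.update_of_ne hwx, hw, Function.update_self]))

theorem adjMatrix_nonneg (D : Digraph V) (i j : V) : 0 ≤ D.adjMatrix ℝ i j := by
  simp only [adjMatrix, Matrix.of_apply]
  split_ifs <;> norm_num

theorem adjMatrix_of_adj {D : Digraph V} {i j : V} (h : D.Adj i j) : D.adjMatrix ℝ i j = 1 := by
  simp [adjMatrix, h]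

theorem adjMatrix_of_not_adj {D : Digraph V} {i j : V} (h : ¬D.Adj i j) :
    D.adjMatrix ℝ i j = 0 := by
  simp [adjMatrix, h]

/-! ### Complementarity eigenvalues as Perron values -/

section Perron

variable [Fintype V]

/-- `x` is a nonnegative vector with support `S` and, on `S`, an eigenvector of the adjacency
matrix of `D` for the value `μ`. -/
structure IsPerronPair (D : Digraph V) (S : Set V) (μ : ℝ) (x : V → ℝ) : Prop where
  pos : ∀ i ∈ S, 0 < x i
  zero : ∀ i ∉ S, x i = 0
  eig : ∀ i ∈ S, (D.adjMatrix ℝ).mulVec x i = μ * x i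

theorem adjMatrix_mulVec_nonneg (D : Digraph V) {x : V → ℝ} (hx : ∀ i, 0 ≤ x i) (i : V) :
    0 ≤ (D.adjMatrix ℝ).mulVec x i :=
  Finset.sum_nonneg fun j _ => mul_nonneg (D.adjMatrix_nonneg i j) (hx j)

theorem IsPerronPair.nonneg {D : Digraph V} {S : Set V} {μ : ℝ} {x : V → ℝ}
    (h : D.IsPerronPair S μ x) (i : V) : 0 ≤ x i := by
  by_cases hi : i ∈ S
  · exact (h.pos i hi).le
  · exact (h.zero i hi).ge

theorem complementaritySpectrum_eq (D : Digraph V) :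
    D.complementaritySpectrum = (D.adjMatrix ℝ).complementaritySpectrum := by
  unfold complementaritySpectrum
  congr!

/-- A sum of nonnegative terms vanishes only termwise, so orthogonality forces `A x = μ x` wherever
`x` is nonzero. Conversely, off the support the inequality reads `0 ≤ A x`. -/
theorem mem_complementaritySpectrum_iff (D : Digraph V) (μ : ℝ) :
    μ ∈ D.complementaritySpectrum ↔
      ∃ S : Set V, S.Nonempty ∧ ∃ x, D.IsPerronPair S μ x := by
  rw [complementaritySpectrum_eq]
  constructor
  · rintro ⟨x, hx0, hx, hle, hdot⟩
    refine ⟨{i | x i ≠ 0}, Function.ne_iff.1 hx0, x, ?_, ?_, ?_⟩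
    · exact fun i hi => lt_of_le_of_ne (hx i) (Ne.symm hi)
    · exact fun i hi => not_not.1 hi
    · intro i hi
      have h0 := (Finset.sum_eq_zero_iff_of_nonneg (fun j _ => mul_nonneg (hx j)
        (sub_nonneg.2 (hle j)))).1 hdot i (Finset.mem_univ i)
      have := (mul_eq_zero.1 h0).resolve_left hi
      simpa using sub_eq_zero.1 this
  · rintro ⟨S, ⟨i0, hi0⟩, x, h⟩
    refine ⟨x, fun h0 => (h.pos i0 hi0).ne' (congrFun h0 i0), h.nonneg, fun i => ?_, ?_⟩
    · by_cases hi : i ∈ S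
      · exact (h.eig i hi).ge
      · rw [Pi.smul_apply, h.zero i hi, smul_zero]
        exact D.adjMatrix_mulVec_nonneg h.nonneg i
    · refine Finset.sum_eq_zero fun i _ => ?_
      by_cases hi : i ∈ S
      · rw [Pi.sub_apply, h.eig i hi, Pi.smul_apply, smul_eq_mul, sub_self, mul_zero]
      · rw [h.zero i hi, zero_mul]

theorem induced_mulVec (D : Digraph V) (S : Set V) [Fintype S] {x : V → ℝ}
    (hx : ∀ i ∉ S, x i = 0) (i : S) :
    ((D.induced S).adjMatrix ℝ).mulVec (fun j => x j) i = (D.adjMatrix ℝ).mulVec x i := by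
  classical
  have h1 : (D.adjMatrix ℝ).mulVec x i =
      ∑ j ∈ S.toFinset, D.adjMatrix ℝ i j * x j := by
    refine (Finset.sum_subset (Finset.subset_univ _) fun j _ hj => ?_).symm
    rw [hx j (by simpa using hj), mul_zero]
  rw [h1, ← Finset.sum_coe_sort S.toFinset]
  exact Fintype.sum_equiv (Equiv.subtypeEquivRight (fun a => by simp)) _ _ (fun j => rfl)

theorem IsStrongOn.exists_isPerronPair {D : Digraph V} {S : Set V} (hS : D.IsStrongOn S)
    (hne : S.Nonempty) : ∃ μ x, D.IsPerronPair S μ x := by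
  classical
  have := hne.to_subtype
  obtain ⟨μ, y, hy, hμ⟩ := Matrix.exists_pos_eigenvector
    (A := (D.induced S).adjMatrix ℝ) (adjMatrix_nonneg _) (fun i j =>
      reflTransGen_map id (fun a b h => one_pos.trans_eq (adjMatrix_of_adj h.1).symm)
        (hS.induced_univ i trivial j trivial))
  have hx : (fun j : S => (fun i => if h : i ∈ S then y ⟨i, h⟩ else 0) (j : V)) = y := by
    funext j; simp
  refine ⟨μ, fun i => if h : i ∈ S then y ⟨i, h⟩ else 0, ?_, ?_, ?_⟩
  · intro i hi
    simpa [hi] using hy ⟨i, hi⟩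
  · intro i hi
    simp [hi]
  · intro i hi
    rw [← D.induced_mulVec S (fun i hi => by simp [hi]) ⟨i, hi⟩, hx, hμ]
    simp [hi]

theorem IsPerronPair.specRadius_eq {D : Digraph V} {S : Set V} {μ : ℝ} {x : V → ℝ}
    (h : D.IsPerronPair S μ x) (hne : S.Nonempty) :
    (D.induced S).specRadius = ENNReal.ofReal μ := by
  classical
  have := hne.to_subtype
  unfold specRadius
  let := Fintype.ofFinite S
  have key := Matrix.spectralRadius_eq_of_pos_eigenvector
    (A := (D.induced S).adjMatrix ℝ) (adjMatrix_nonneg _) (x := fun j => x j)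
    (fun i => h.pos i i.2) (fun i => by rw [D.induced_mulVec S h.zero, h.eig i i.2])
  rw [← key]
  have : (D.induced S).adjMatrix ℂ = ((D.induced S).adjMatrix ℝ).map Complex.ofReal := by
    ext i j
    by_cases hij : (D.induced S).Adj i j <;> simp [adjMatrix, hij]
  rw [← this]
  congr!

/-- Strict monotonicity of the Perron value. -/
theorem IsPerronPair.lt_of_ssubset {D : Digraph V} {S T : Set V} {lam μ : ℝ} {x y : V → ℝ}
    (hS : D.IsStrongOn S) (hx : D.IsPerronPair S lam x) (hy : D.IsPerronPair T μ y)
    (hTS : T ⊂ S) (hT : T.Nonempty) : μ < lam := by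
  by_contra! hle
  obtain ⟨i0, hi0, hmin⟩ := Set.exists_min_image T (fun i => x i / y i) T.toFinite hT
  -- This is the largest `c` with `c y ≤ x`. If `lam ≤ μ`, the zero of `x - c y` at `i0` spreads
  -- through `S`; but outside `T` this difference is `x`, which is positive on `S`.
  set c := x i0 / y i0 with hc
  have hc0 : 0 ≤ c := div_nonneg (hx.nonneg i0) (hy.nonneg i0)
  have hz : ∀ i, 0 ≤ x i - c * y i := by
    intro i
    by_cases hi : i ∈ T
    · have := (le_div_iff₀ (hy.pos i hi)).1 (hmin i hi)
      linarith
    · rw [hy.zero i hi, mul_zero, sub_zero]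
      exact hx.nonneg i
  have hz0 : x i0 - c * y i0 = 0 := by
    rw [hc, div_mul_cancel₀ _ (hy.pos i0 hi0).ne', sub_self]
  have hyle : ∀ i, μ * y i ≤ (D.adjMatrix ℝ).mulVec y i := by
    intro i
    by_cases hi : i ∈ T
    · exact (hy.eig i hi).ge
    · rw [hy.zero i hi, mul_zero]
      exact D.adjMatrix_mulVec_nonneg hy.nonneg i
  have hAz : ∀ i ∈ S, ∑ j, D.adjMatrix ℝ i j * (x j - c * y j) ≤ lam * (x i - c * y i) := by
    intro i hi
    have h1 : ∑ j, D.adjMatrix ℝ i j * (x j - c * y j) =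
        (D.adjMatrix ℝ).mulVec x i - c * (D.adjMatrix ℝ).mulVec y i := by
      simp only [Matrix.mulVec, dotProduct, Finset.mul_sum, ← Finset.sum_sub_distrib]
      exact Finset.sum_congr rfl fun j _ => by ring
    rw [h1, hx.eig i hi]
    have h2 := mul_le_mul_of_nonneg_left (hyle i) hc0
    have h3 := mul_le_mul_of_nonneg_right hle (mul_nonneg hc0 (hy.nonneg i))
    linarith
  have hall := hS.forall_of_closed (p := fun i => x i - c * y i = 0) (hTS.1 hi0) hz0
    (fun a ha hpa b _ hab => by
      have h1 := hAz a ha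
      rw [hpa, mul_zero] at h1
      have h2 := (Finset.sum_eq_zero_iff_of_nonneg (fun j _ => mul_nonneg
        (D.adjMatrix_nonneg a j) (hz j))).1 (le_antisymm h1 (Finset.sum_nonneg fun j _ =>
          mul_nonneg (D.adjMatrix_nonneg a j) (hz j))) b (Finset.mem_univ b)
      rwa [adjMatrix_of_adj hab, one_mul] at h2)
  obtain ⟨k, hkS, hkT⟩ := Set.exists_of_ssubset hTS
  have h1 := hall k hkS
  simp only [hy.zero k hkT, mul_zero, sub_zero] at h1
  exact (hx.pos k hkS).ne' h1

theorem isPerronPair_singleton {D : Digraph V} {v : V} (hv : ¬D.Adj v v) :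
    D.IsPerronPair {v} 0 (Set.indicator {v} 1) := by
  classical
  refine ⟨fun i hi => by simp [Set.indicator_of_mem hi], fun i hi => by simp [hi], ?_⟩
  rintro i rfl
  rw [zero_mul]
  refine Finset.sum_eq_zero fun j _ => ?_
  by_cases hj : j = i
  · subst hj
    change D.adjMatrix ℝ j j * _ = 0
    rw [adjMatrix_of_not_adj hv, zero_mul]
  · simp [hj]

theorem isPerronPair_of_functional {D : Digraph V} {T : Set V} (hT : D.IsFunctionalOn T)
    (hadj : ∀ u ∈ T, ∃ v ∈ T, D.Adj u v) : D.IsPerronPair T 1 (T.indicator 1) := by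
  classical
  refine ⟨fun i hi => by simp [Set.indicator_of_mem hi], fun i hi => by simp [hi], ?_⟩
  intro i hi
  obtain ⟨v, hv, hiv⟩ := hadj i hi
  rw [one_mul, Set.indicator_of_mem hi]
  refine (Finset.sum_eq_single v (fun j _ hj => ?_) (by simp)).trans ?_
  · by_cases hjT : j ∈ T
    · change D.adjMatrix ℝ i j * _ = 0
      rw [adjMatrix_of_not_adj (fun h => hj (hT i hi j hjT v hv h hiv)), zero_mul]
    · simp [hjT]
  · change D.adjMatrix ℝ i v * _ = _
    rw [adjMatrix_of_adj hiv, Set.indicator_of_mem hv]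
    simp

/-- If all strongly connected components are single vertices or directed cycles, then the
complementarity eigenvalues are among `0` and `1`. -/
theorem complementaritySpectrum_subset_of_functional {D : Digraph V}
    (h : ∀ S ∈ D.strongComponents, D.IsFunctionalOn S) :
    D.complementaritySpectrum ⊆ {0, 1} := by
  intro μ hμ
  obtain ⟨X, hX, x, hx⟩ := (D.mem_complementaritySpectrum_iff μ).1 hμ
  -- `Q` is a terminal strong component of the support. No arc leads from `Q` to the rest of the
  -- support, so on `Q` the eigenvalue equation involves only `Q`.
  obtain ⟨Q, hQX, ⟨⟨v, hv⟩, hQ⟩, hmin⟩ := exists_minimal_le_of_wellFoundedLT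
    (fun Q : Set V => Q.Nonempty ∧ ∀ u ∈ Q, ∀ w ∈ X, D.Adj u w → w ∈ Q) X
    ⟨hX, fun _ _ w hw _ => hw⟩
  have hQX : Q ⊆ X := hQX
  have hstrong : D.IsStrongOn Q := by
    intro a ha b hb
    have hRQ : {w | ReflTransGen (fun a b => D.Adj a b ∧ b ∈ Q) a w} ⊆ Q :=
      fun w hw => mem_of_reflTransGen ha hw
    refine hmin (y := {w | ReflTransGen (fun a b => D.Adj a b ∧ b ∈ Q) a w})
      ⟨⟨a, ReflTransGen.refl⟩, fun u hu w hw huw => ?_⟩ hRQ hb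
    exact ReflTransGen.tail hu ⟨huw, hQ u (hRQ hu) w hw huw⟩
  have hfun : D.IsFunctionalOn Q :=
    (h _ ⟨v, rfl⟩).mono (hstrong.subset_strongComponent hv)
  have hzero : ∀ a ∈ Q, ∀ j, ¬(j ∈ Q ∧ D.Adj a j) → D.adjMatrix ℝ a j * x j = 0 := by
    intro a ha j hj
    by_cases haj : D.Adj a j
    · rw [hx.zero j (fun hjX => hj ⟨hQ a ha j hjX haj, haj⟩), mul_zero]
    · rw [adjMatrix_of_not_adj haj, zero_mul]
  by_cases hadj : ∀ a ∈ Q, ∃ b ∈ Q, D.Adj a b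
  · right
    -- With a unique successor, each step multiplies `x` by `μ`; the maximum of `x` then gives `μ ≤
    -- 1` and the minimum `1 ≤ μ`.
    have hstep : ∀ a ∈ Q, ∃ b ∈ Q, x b = μ * x a := by
      intro a ha
      obtain ⟨b, hb, hab⟩ := hadj a ha
      refine ⟨b, hb, ?_⟩
      rw [← hx.eig a (hQX ha)]
      refine Eq.symm ((Finset.sum_eq_single b (fun j _ hj => ?_) (by simp)).trans ?_)
      · exact hzero a ha j fun hj' => hj (hfun a ha j hj'.1 b hb hj'.2 hab)
      · change D.adjMatrix ℝ a b * _ = _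
        rw [adjMatrix_of_adj hab, one_mul]
    obtain ⟨a, ha, hamax⟩ := Set.exists_max_image Q x Q.toFinite ⟨v, hv⟩
    obtain ⟨b, hb, hbmin⟩ := Set.exists_min_image Q x Q.toFinite ⟨v, hv⟩
    obtain ⟨a', ha', haa⟩ := hstep a ha
    obtain ⟨b', hb', hbb⟩ := hstep b hb
    have hxa := hx.pos a (hQX ha)
    have hxb := hx.pos b (hQX hb)
    have h1 := hamax a' ha'
    have h2 := hbmin b' hb'
    rw [haa] at h1
    rw [hbb] at h2
    have h3 : μ ≤ 1 := le_of_mul_le_mul_right (by linarith) hxa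
    have h4 : 1 ≤ μ := le_of_mul_le_mul_right (by linarith) hxb
    exact le_antisymm h3 h4
  · left
    push Not at hadj
    obtain ⟨a, ha, hna⟩ := hadj
    have h1 := hx.eig a (hQX ha)
    have h2 : (D.adjMatrix ℝ).mulVec x a = 0 :=
      Finset.sum_eq_zero fun j _ => hzero a ha j fun hj => hna j hj.1 hj.2
    rw [h2] at h1
    exact (mul_eq_zero.1 h1.symm).resolve_right (hx.pos a (hQX ha)).ne'

/-- A strongly connected vertex set that is neither a single vertex nor a directed cycle has Perron
value greater than `1`, and then `1` is a complementarity eigenvalue. -/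
theorem IsStrongOn.one_lt_of_not_functional {D : Digraph V} {S : Set V} (hS : D.IsStrongOn S)
    (hnf : ¬D.IsFunctionalOn S) {μ : ℝ} {x : V → ℝ} (hx : D.IsPerronPair S μ x) :
    1 < μ ∧ 1 ∈ D.complementaritySpectrum := by
  have hnt : S.Nontrivial := by
    by_contra h
    rw [Set.not_nontrivial_iff] at h
    exact hnf fun x _ y hy z hz _ _ => h hy hz
  obtain ⟨T, hTS, hTne, -, hTf, hTadj⟩ := exists_strong_functional hnt.nonempty
    (fun u hu => hS.exists_adj hnt hu)
  have hT := isPerronPair_of_functional hTf hTadj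
  refine ⟨hx.lt_of_ssubset hS hT (hTS.ssubset_of_ne ?_) hTne,
    (D.mem_complementaritySpectrum_iff 1).2 ⟨T, hTne, _, hT⟩⟩
  rintro rfl
  exact hnf hTf

end Perron

end Digraph

/-! ### Renumberings of a cycle with an ear into the listed types -/

namespace Digraph

/-- Arcs of a cycle `0 → ⋯ → m - 1 → 0` with an ear `m → ⋯ → m + k` that is entered from `i₀`, `i₁`
and left towards `j₀`, `j₁`. -/
def EarArc (m k i₀ i₁ j₀ j₁ i j : ℕ) : Prop :=
  (i < m ∧ j < m ∧ (j = i + 1 ∨ (i + 1 = m ∧ j = 0))) ∨ (j = m ∧ (i = i₀ ∨ i = i₁)) ∨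
  (m ≤ i ∧ j = i + 1) ∨ (i = m + k ∧ (j = j₀ ∨ j = j₁))

/-- Some bijection from `1, …, N` to `0, …, N - 1` carries the relation `R'` to `R`. -/
def Renumbers (N : ℕ) (R R' : ℕ → ℕ → Prop) : Prop :=
  ∃ σ : ℕ → ℕ, (∀ x, 1 ≤ x → x ≤ N → σ x < N) ∧
    (∀ x y, 1 ≤ x → x ≤ N → 1 ≤ y → y ≤ N → σ x = σ y → x = y) ∧
    ∀ x y, 1 ≤ x → x ≤ N → 1 ≤ y → y ≤ N → (R (σ x) (σ y) ↔ R' x y)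

theorem renumbers_infty (m k : ℕ) (hm : 2 ≤ m) :
    Renumbers (m + k + 1) (EarArc m k 0 0 0 0) (InftyArc m (k + 2)) := by
  refine ⟨fun x => x - 1, by grind, by grind, ?_⟩
  intro x y _ _ _ _
  unfold EarArc InftyArc PathArc
  grind

theorem renumbers_theta (a k c : ℕ) :
    Renumbers (a + c + 2 + k + 1) (EarArc (a + c + 2) k (c + 1) (c + 1) 0 0)
      (ThetaArc a (k + 1) c) := by
  refine ⟨fun x => if x = 1 then c + 1 else if x = 2 then 0 else if x ≤ 2 + a then c + (x - 1)
    else if x ≤ 2 + a + (k + 1) then x + c - 1 else x - (2 + a + (k + 1)), by grind, by grind, ?_⟩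
  intro x y _ _ _ _
  unfold EarArc ThetaArc PathArc
  grind (splits := 40)

/-- The list requires the shorter of the two parallel paths to come first; here that is the one
through the ear. -/
theorem renumbers_theta_swap (a k c : ℕ) (ha : k + 1 ≤ a) :
    Renumbers (a + c + 2 + k + 1) (EarArc (a + c + 2) k (c + 1) (c + 1) 0 0)
      (ThetaArc (k + 1) a c) := by
  refine ⟨fun x => if x = 1 then c + 1 else if x = 2 then 0 else if x ≤ 3 + k then a + c + x - 1
    else if x ≤ 3 + k + a then c + x - 2 - k else x - (3 + k + a), by grind, by grind, ?_⟩
  intro x y _ _ _ _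
  unfold EarArc ThetaArc PathArc
  grind (splits := 40)

theorem renumbers_type1 (m k : ℕ) :
    Renumbers (m + 2 + k + 1) (EarArc (m + 2) k 0 (m + 1) 0 0)
      (fun x y => InftyArc (m + 2) (k + 2) x y ∨ (x = m + 2 ∧ y = m + 2 + 1)) := by
  refine ⟨fun x => x - 1, by grind, by grind, ?_⟩
  intro x y _ _ _ _
  unfold EarArc InftyArc PathArc
  grind (splits := 40)

/-- The cycle followed by the ear is Hamiltonian. It is rotated so that `c + 1` becomes vertex `1`;
the additional arcs are the early entry to the ear and the closing arc of the original cycle. -/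
theorem renumbers_type3 (c e k : ℕ) :
    Renumbers (c + e + 3 + k + 1) (EarArc (c + e + 3) k (c + 1) (c + e + 2) 0 0)
      (fun x y => CycleArc (c + e + 3 + k + 1) x y ∨ (x = 1 ∧ y = e + 3) ∨
        (x = e + 3 - 1 ∧ y = e + k + 4)) := by
  refine ⟨fun x => if x + c < c + e + 3 + k + 1 then x + c else x + c - (c + e + 3 + k + 1),
    by grind, by grind, ?_⟩
  intro x y _ _ _ _
  unfold EarArc CycleArc
  grind (splits := 40)

theorem renumbers_type1_of_last (m k : ℕ) :
    Renumbers (m + 2 + k + 1) (EarArc (m + 2) k (m + 1) (m + 1) 0 (m + 1))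
      (fun x y => InftyArc (k + 2) (m + 2) x y ∨ (x = k + 2 ∧ y = k + 2 + 1)) := by
  refine ⟨fun x => if x = 1 then m + 1 else if x ≤ k + 2 then m + x else x - (k + 3),
    by grind, by grind, ?_⟩
  intro x y _ _ _ _
  unfold EarArc InftyArc PathArc
  grind (splits := 40)

theorem renumbers_type3_of_last (c e k : ℕ) :
    Renumbers (c + e + 3 + k + 1) (EarArc (c + e + 3) k (c + e + 2) (c + e + 2) 0 (c + 1))
      (fun x y => CycleArc (c + e + 3 + k + 1) x y ∨ (x = 1 ∧ y = k + 3) ∨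
        (x = k + 3 - 1 ∧ y = k + c + 4)) := by
  refine ⟨fun x => if x = 1 then c + e + 2 else if x ≤ k + 2 then c + e + 1 + x else x - (k + 3),
    by grind, by grind, ?_⟩
  intro x y _ _ _ _
  unfold EarArc CycleArc
  grind (splits := 40)

theorem renumbers_type1_of_first (m k : ℕ) :
    Renumbers (m + 2 + k + 1) (EarArc (m + 2) k 0 0 0 1)
      (fun x y => InftyArc (k + 2) (m + 2) x y ∨ (x = k + 2 ∧ y = k + 2 + 1)) := by
  refine ⟨fun x => if x = 1 then 0 else if x ≤ k + 2 then m + x else x - (k + 2),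
    by grind, by grind, ?_⟩
  intro x y _ _ _ _
  unfold EarArc InftyArc PathArc
  grind (splits := 40)

/-- Here the Hamiltonian cycle inserts the ear between `c + 1` and `c + 2`; the arc it bypasses and
the second exit of the ear are the additional arcs. -/
theorem renumbers_type3_of_first (c e k : ℕ) :
    Renumbers (c + e + 3 + k + 1) (EarArc (c + e + 3) k (c + 1) (c + 1) 0 (c + 2))
      (fun x y => CycleArc (c + e + 3 + k + 1) x y ∨ (x = 1 ∧ y = k + 3) ∨
        (x = k + 3 - 1 ∧ y = k + e + 4)) := by
  refine ⟨fun x => if x = 1 then c + 1 else if x ≤ k + 2 then c + e + 1 + x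
    else if x ≤ k + e + 3 then x + c - k - 1 else x - (k + e + 4), by grind, by grind, ?_⟩
  intro x y _ _ _ _
  unfold EarArc CycleArc
  grind (splits := 40)

/-- Two entries and two exits give three paths (two segments of the cycle and the ear), with an arc
from the end of each to the start of each other. Type 2 arises when one of the paths is a single
vertex: the first segment here, the second segment or the ear in the two variants that follow. -/
theorem renumbers_type2 (m k : ℕ) :
    Renumbers (m + 2 + k + 1) (EarArc (m + 2) k 0 (m + 1) 0 1)
      (fun x y => InftyArc (m + 2) (k + 2) x y ∨ (x = m + 2 ∧ y = m + 2 + 1) ∨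
        (x = m + 2 + (k + 2) - 1 ∧ y = 2)) := by
  refine ⟨fun x => x - 1, by grind, by grind, ?_⟩
  intro x y _ _ _ _
  unfold EarArc InftyArc PathArc
  grind (splits := 40)

theorem renumbers_type2_of_last (c k : ℕ) :
    Renumbers (c + 2 + k + 1) (EarArc (c + 2) k c (c + 1) 0 (c + 1))
      (fun x y => InftyArc (c + 2) (k + 2) x y ∨ (x = c + 2 ∧ y = c + 2 + 1) ∨
        (x = c + 2 + (k + 2) - 1 ∧ y = 2)) := by
  refine ⟨fun x => if x = 1 then c + 1 else if x ≤ c + 2 then x - 2 else x - 1,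
    by grind, by grind, ?_⟩
  intro x y _ _ _ _
  unfold EarArc InftyArc PathArc
  grind (splits := 40)

theorem renumbers_type2_of_short (c d : ℕ) :
    Renumbers (c + d + 2 + 0 + 1) (EarArc (c + d + 2) 0 c (c + d + 1) 0 (c + 1))
      (fun x y => InftyArc (c + 2) (d + 2) x y ∨ (x = c + 2 ∧ y = c + 2 + 1) ∨
        (x = c + 2 + (d + 2) - 1 ∧ y = 2)) := by
  refine ⟨fun x => if x = 1 then c + d + 2 else x - 2, by grind, by grind, ?_⟩
  intro x y _ _ _ _
  unfold EarArc InftyArc PathArc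
  grind (splits := 40)

/-- The case in which all three paths have at least two vertices; an ear of at least two vertices is
what `i + 1 < j` demands. -/
theorem renumbers_type5 (c d l : ℕ) :
    Renumbers (c + d + 4 + (l + 1) + 1) (EarArc (c + d + 4) (l + 1) (c + 1) (c + d + 3) 0 (c + 2))
      (fun x y => CycleArc (c + d + 4 + (l + 1) + 1) x y ∨ (x = 1 ∧ y = d + 4) ∨
        (x = d + 4 - 1 ∧ y = d + l + 6) ∨ (x = d + l + 6 - 1 ∧ y = 2)) := by
  refine ⟨fun x => if x + c < c + d + 4 + (l + 1) + 1 then x + c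
    else x + c - (c + d + 4 + (l + 1) + 1), by grind, by grind, ?_⟩
  intro x y _ _ _ _
  unfold EarArc CycleArc
  grind (splits := 40)

end Digraph

/-! ### Minimal digraphs as a cycle with a shortest ear -/

namespace Digraph

open Relation

variable {V : Type*} {D : Digraph V}

theorem isStrongOn_of_closedWalk {q : ℕ → V} {n : ℕ} (hq : ∀ i < n, D.Adj (q i) (q (i + 1)))
    (hn : D.Adj (q n) (q 0)) : D.IsStrongOn (q '' Set.Iic n) := by
  have hup : ∀ i j, i ≤ j → j ≤ n →
      ReflTransGen (fun a b => D.Adj a b ∧ b ∈ q '' Set.Iic n) (q i) (q j) := by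
    intro i j hij
    induction j, hij using Nat.le_induction with
    | base => exact fun _ => ReflTransGen.refl
    | succ j hij ih =>
      intro hj
      exact (ih (by omega)).tail ⟨hq j (by omega), j + 1, hj, rfl⟩
  rintro _ ⟨i, hi, rfl⟩ _ ⟨j, hj, rfl⟩
  exact ((hup i n hi le_rfl).tail ⟨hn, 0, Nat.zero_le n, rfl⟩).trans (hup 0 j (Nat.zero_le j) hj)

/-- Enumeration of a directed cycle along its arcs, starting at a given vertex. -/
theorem exists_cycle_enumeration [Finite V] {C : Set V} (hloop : ∀ v, ¬D.Adj v v)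
    (hC : D.IsStrongOn C) (hfun : D.IsFunctionalOn C) (hadj : ∀ u ∈ C, ∃ v ∈ C, D.Adj u v)
    {c₀ : V} (hc₀ : c₀ ∈ C) :
    ∃ (m : ℕ) (c : ℕ → V), 2 ≤ m ∧ c 0 = c₀ ∧ (∀ i, c i ∈ C) ∧ (∀ v ∈ C, ∃ i < m, c i = v) ∧
      (∀ i j, c i = c j ↔ i ≡ j [MOD m]) ∧ ∀ i j, D.Adj (c i) (c j) ↔ j ≡ i + 1 [MOD m] := by
  choose! s hs using hadj
  let c : ℕ → V := fun i => s^[i] c₀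
  have hsucc : ∀ i, c (i + 1) = s (c i) := fun i => Function.iterate_succ_apply' s i c₀
  have hcC : ∀ i, c i ∈ C := by
    intro i
    induction i with
    | zero => exact hc₀
    | succ i ih => rw [hsucc]; exact (hs _ ih).1
  have hcadj : ∀ i, D.Adj (c i) (c (i + 1)) := fun i => by rw [hsucc]; exact (hs _ (hcC i)).2
  have hcov : ∀ v ∈ C, ∃ i, c (i + 1) = v := by
    refine hC.forall_of_closed (u := c 1) (hcC 1) ⟨0, rfl⟩ ?_
    rintro _ - ⟨i, rfl⟩ b hb hab
    exact ⟨i + 1, hfun _ (hcC (i + 1)) _ (hcC _) _ hb (hcadj (i + 1)) hab⟩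
  obtain ⟨p, hp⟩ := hcov c₀ hc₀
  have hper : c₀ ∈ Function.periodicPts s := ⟨p + 1, Nat.succ_pos p, hp⟩
  set m := Function.minimalPeriod s c₀ with hm
  have hm0 : 0 < m := Function.minimalPeriod_pos_of_mem_periodicPts hper
  have hmod : ∀ i, c (i % m) = c i := fun i => Function.iterate_mod_minimalPeriod_eq
  have hceq : ∀ i j, c i = c j ↔ i ≡ j [MOD m] := by
    intro i j
    rw [← hmod i, ← hmod j]
    constructor
    · intro h
      exact Function.iterate_injOn_Iio_minimalPeriod (Nat.mod_lt i hm0) (Nat.mod_lt j hm0) h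
    · intro h
      rw [show i % m = j % m from h]
  refine ⟨m, c, ?_, rfl, hcC, ?_, hceq, ?_⟩
  · by_contra hlt
    have hm1 : m = 1 := by omega
    have h01 : c 0 = c 1 := (hceq 0 1).2 (by rw [hm1]; exact Nat.modEq_one)
    have := hcadj 0
    rw [zero_add, ← h01] at this
    exact hloop _ this
  · intro v hv
    obtain ⟨i, rfl⟩ := hcov v hv
    exact ⟨(i + 1) % m, Nat.mod_lt _ hm0, hmod _⟩
  · intro i j
    rw [← hceq]
    constructor
    · exact fun h => hfun _ (hcC i) _ (hcC j) _ (hcC _) h (hcadj i)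
    · exact fun h => h ▸ hcadj i

theorem modEq_succ_iff {m i j : ℕ} (hi : i < m) (hj : j < m) :
    j ≡ i + 1 [MOD m] ↔ j = i + 1 ∨ (i + 1 = m ∧ j = 0) := by
  unfold Nat.ModEq
  rw [Nat.mod_eq_of_lt hj]
  rcases Nat.lt_or_ge (i + 1) m with h | h
  · rw [Nat.mod_eq_of_lt h]; omega
  · have h' : i + 1 = m := by omega
    rw [h', Nat.mod_self]; omega

/-- A digraph is given by relations on `1, …, n` if some injective enumeration matches the arcs. -/
theorem isoTo_of_injective [Finite V] {n : ℕ} (hcard : Nat.card V = n) {R : ℕ → ℕ → Prop}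
    (g : ℕ → V) (hg : ∀ x y, 1 ≤ x → x ≤ n → 1 ≤ y → y ≤ n → g x = g y → x = y)
    (hR : ∀ x y, 1 ≤ x → x ≤ n → 1 ≤ y → y ≤ n → (D.Adj (g x) (g y) ↔ R x y)) :
    D.IsoTo n R := by
  have hinj : Function.Injective fun x : Set.Icc 1 n => g x := fun x y h =>
    Subtype.ext (hg x y x.2.1 x.2.2 y.2.1 y.2.2 h)
  have hbij := (Nat.bijective_iff_injective_and_card (fun x : Set.Icc 1 n => g x)).2
    ⟨hinj, by rw [hcard]; simp⟩
  let e := Equiv.ofBijective _ hbij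
  have he : ∀ v, g (e.symm v) = v := fun v => e.apply_symm_apply v
  refine ⟨e.symm, fun u v => ?_⟩
  rw [← hR _ _ (e.symm u).2.1 (e.symm u).2.2 (e.symm v).2.1 (e.symm v).2.2, he, he]

theorem isIsolatedVertex_or_isCycle [Finite V] [Nonempty V] (hloop : ∀ v, ¬D.Adj v v)
    (hD : D.IsStrongOn Set.univ) (hfun : D.IsFunctionalOn Set.univ) :
    D.IsIsolatedVertex ∨ D.IsCycle := by
  obtain ⟨v₀⟩ := ‹Nonempty V›
  rcases subsingleton_or_nontrivial V with hV | hV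
  · left
    refine isoTo_of_injective (Nat.card_eq_one_iff_unique.2 ⟨hV, ⟨v₀⟩⟩) (fun _ => v₀)
      (by omega) fun x y _ _ _ _ => by simpa using hloop v₀
  · right
    obtain ⟨m, c, hm, -, -, hcov, hceq, hcadj⟩ := exists_cycle_enumeration hloop hD hfun
      (fun u hu => hD.exists_adj Set.nontrivial_univ hu) (Set.mem_univ v₀)
    have hcard : Nat.card V = m := by
      have hbij : Function.Bijective fun i : Fin m => c i := by
        refine ⟨fun i j h => Fin.ext ?_, fun v => ?_⟩
        · have := (hceq i j).1 h
          unfold Nat.ModEq at this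
          rwa [Nat.mod_eq_of_lt i.2, Nat.mod_eq_of_lt j.2] at this
        · obtain ⟨i, hi, hv⟩ := hcov v trivial
          exact ⟨⟨i, hi⟩, hv⟩
      rw [← Nat.card_eq_of_bijective _ hbij, Nat.card_eq_fintype_card, Fintype.card_fin]
    refine ⟨m, hm, isoTo_of_injective hcard (fun x => c (x - 1)) ?_ ?_⟩
    · intro x y hx hxm hy hym h
      have := (hceq _ _).1 h
      unfold Nat.ModEq at this
      rw [Nat.mod_eq_of_lt (by omega), Nat.mod_eq_of_lt (by omega)] at this
      omega
    · intro x y hx hxm hy hym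
      rw [hcadj, modEq_succ_iff (by omega) (by omega)]
      unfold CycleArc
      omega

/-- A strongly connected digraph presented as an induced cycle `c 0 → ⋯ → c (m - 1) → c 0` and an
ear `p 0 → ⋯ → p k` of minimal length outside the cycle; the cycle is numbered so that `p k` has an
arc to `c 0`. -/
structure IsEarEnumeration (D : Digraph V) (m k : ℕ) (c p : ℕ → V) : Prop where
  two_le : 2 ≤ m
  cover : ∀ v, (∃ i < m, c i = v) ∨ ∃ i ≤ k, p i = v
  c_eq : ∀ i j, c i = c j ↔ i ≡ j [MOD m]
  p_inj : ∀ i ≤ k, ∀ j ≤ k, p i = p j → i = j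
  c_ne_p : ∀ i, ∀ j ≤ k, c i ≠ p j
  c_adj : ∀ i j, D.Adj (c i) (c j) ↔ j ≡ i + 1 [MOD m]
  c_p : ∀ i, ∀ j ≤ k, D.Adj (c i) (p j) → j = 0
  p_c : ∀ i ≤ k, ∀ j, D.Adj (p i) (c j) → i = k
  p_adj : ∀ i < k, D.Adj (p i) (p (i + 1))
  p_p : ∀ i ≤ k, ∀ j ≤ k, D.Adj (p i) (p j) → j ≤ i + 1
  entry : ∃ i < m, D.Adj (c i) (p 0)
  exit : D.Adj (p k) (c 0)

/-- A path of `k + 1` vertices outside `C` that starts at an out-neighbour of `C` and ends at an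
in-neighbour of `C`. -/
def IsEar (D : Digraph V) (C : Set V) (k : ℕ) (p : ℕ → V) : Prop :=
  (∀ i ≤ k, p i ∉ C) ∧ (∀ i < k, D.Adj (p i) (p (i + 1))) ∧ (∃ u ∈ C, D.Adj u (p 0)) ∧
    ∃ w ∈ C, D.Adj (p k) w

theorem exists_isEar {C : Set V} (hD : D.IsStrongOn Set.univ) (hC : C.Nonempty)
    (hne : C ≠ Set.univ) : ∃ k p, D.IsEar C k p := by
  obtain ⟨u, huC⟩ := hC
  obtain ⟨v, hv⟩ := (Set.ne_univ_iff_exists_notMem C).1 hne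
  have hout : ∃ a ∈ C, ∃ b ∉ C, D.Adj a b := by
    by_contra! h
    exact hv (hD.forall_of_closed (p := (· ∈ C)) (Set.mem_univ u) huC (fun a _ ha b _ hab => by
      by_contra hb
      exact h a ha b hb hab) v trivial)
  obtain ⟨a, ha, b, hb, hab⟩ := hout
  -- A walk from `x` to `u` is cut where it first enters `C`.
  have key : ∀ x, ReflTransGen (fun a b => D.Adj a b ∧ b ∈ Set.univ) x u → x ∉ C →
      ∃ (k : ℕ) (p : ℕ → V), p 0 = x ∧ (∀ i ≤ k, p i ∉ C) ∧ (∀ i < k, D.Adj (p i) (p (i + 1))) ∧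
        ∃ w ∈ C, D.Adj (p k) w := by
    intro x hx
    induction hx using ReflTransGen.head_induction_on with
    | refl => exact fun h => absurd huC h
    | @head x y hxy _ ih =>
      intro hxC
      by_cases hy : y ∈ C
      · exact ⟨0, fun _ => x, rfl, fun _ _ => hxC, by simp, y, hy, hxy.1⟩
      · obtain ⟨k, p, hp0, hpC, hpadj, w, hw, hpw⟩ := ih hy
        refine ⟨k + 1, fun i => if i = 0 then x else p (i - 1), by simp, ?_, ?_, w, hw, by simpa⟩
        · intro i hi
          dsimp only
          split_ifs with h
          · exact hxC
          · exact hpC _ (by omega)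
        · intro i hi
          rcases i with _ | i
          · simpa [hp0] using hxy.1
          · simpa using hpadj i (by omega)
  obtain ⟨k, p, hp0, hpC, hpadj, hw⟩ := key b (hD b trivial u trivial) hb
  exact ⟨k, p, hpC, hpadj, ⟨a, ha, hp0 ▸ hab⟩, hw⟩

/-- Strongly connected digraphs that are not a cycle (or a vertex) but all of whose proper strongly
connected induced subdigraphs are: a cycle with one ear. -/
theorem exists_isEarEnumeration [Finite V] [Nonempty V] (hloop : ∀ v, ¬D.Adj v v)
    (hD : D.IsStrongOn Set.univ) (hnf : ¬D.IsFunctionalOn Set.univ)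
    (hprop : ∀ T : Set V, T ≠ Set.univ → D.IsStrongOn T → D.IsFunctionalOn T) :
    ∃ m k c p, D.IsEarEnumeration m k c p := by
  have hnt : (Set.univ : Set V).Nontrivial := by
    by_contra h
    rw [Set.not_nontrivial_iff] at h
    exact hnf fun x _ y hy z hz _ _ => h hy hz
  obtain ⟨C, -, hCne, hCs, hCf, hCadj⟩ := exists_strong_functional (D := D) Set.univ_nonempty
    (fun u hu => hD.exists_adj hnt hu)
  have hCuniv : C ≠ Set.univ := by rintro rfl; exact hnf hCf
  classical
  -- The ear is chosen as short as possible: a forward chord, a later entry, an earlier exit or a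
  -- repeated vertex would each lead to a shorter one.
  have hex : ∃ k, ∃ p, D.IsEar C k p := exists_isEar hD hCne hCuniv
  obtain ⟨p, hpC, hpadj, ⟨u, huC, hup⟩, w, hwC, hpw⟩ := Nat.find_spec hex
  have hmin : ∀ k' p', D.IsEar C k' p' → Nat.find hex ≤ k' :=
    fun k' p' h => Nat.find_min' hex ⟨p', h⟩
  set k := Nat.find hex with hk
  have hchord : ∀ i ≤ k, ∀ j ≤ k, D.Adj (p i) (p j) → j ≤ i + 1 := by
    intro i hi j hj hij
    by_contra! hlt
    have := hmin (k - (j - i - 1)) (fun t => if t ≤ i then p t else p (t + (j - i - 1))) ?_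
    · omega
    refine ⟨?_, ?_, ⟨u, huC, by simpa using hup⟩, w, hwC, ?_⟩
    · intro t ht
      dsimp only
      split_ifs
      · exact hpC t (by omega)
      · exact hpC _ (by omega)
    · intro t ht
      dsimp only
      rcases lt_trichotomy t i with h | h | h
      · rw [if_pos (by omega), if_pos (by omega)]
        exact hpadj t (by omega)
      · subst h
        rw [if_pos le_rfl, if_neg (by omega), show t + 1 + (j - t - 1) = j by omega]
        exact hij
      · rw [if_neg (by omega), if_neg (by omega),
          show t + 1 + (j - i - 1) = t + (j - i - 1) + 1 by omega]
        exact hpadj _ (by omega)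
    · dsimp only
      rw [if_neg (by omega), show k - (j - i - 1) + (j - i - 1) = k by omega]
      exact hpw
  have hin : ∀ x ∈ C, ∀ j ≤ k, D.Adj x (p j) → j = 0 := by
    intro x hx j hj hxj
    by_contra h0
    have := hmin (k - j) (fun t => p (t + j)) ⟨fun t ht => hpC _ (by omega), fun t ht => ?_,
      ⟨x, hx, by simpa using hxj⟩, w, hwC, by dsimp only; rwa [Nat.sub_add_cancel hj]⟩
    · omega
    · have := hpadj (t + j) (by omega)
      rwa [show t + j + 1 = t + 1 + j by omega] at this
  have hout : ∀ j ≤ k, ∀ x ∈ C, D.Adj (p j) x → j = k := by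
    intro j hj x hx hjx
    have := hmin j p ⟨fun t ht => hpC _ (by omega), fun t ht => hpadj t (by omega),
      ⟨u, huC, hup⟩, x, hx, hjx⟩
    omega
  have hpinj : ∀ i j, i < j → j ≤ k → p i ≠ p j := by
    intro i j hij hj heq
    rcases hj.lt_or_eq with hj' | rfl
    · have := hchord i (by omega) (j + 1) hj' (heq ▸ hpadj j hj')
      omega
    · have := hout i (by omega) w hwC (heq ▸ hpw)
      omega
  obtain ⟨m, c, hm, hc0, hcC, hccov, hceq, hcadj⟩ :=
    exists_cycle_enumeration hloop hCs hCf hCadj hwC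
  obtain ⟨i₀, hi₀, rfl⟩ := hccov u huC
  have hcp : ∀ i, ∀ j ≤ k, c i ≠ p j := fun i j hj h => hpC j hj (h ▸ hcC i)
  refine ⟨m, k, c, p, hm, ?_, hceq, ?_, hcp, hcadj, fun i => hin _ (hcC i),
    fun i hi j => hout i hi _ (hcC j), hpadj, hchord, ⟨i₀, hi₀, hup⟩, hc0 ▸ hpw⟩
  -- The closed walk through `c 0, …, c i₀` and the ear, joined with `C`, is strongly connected and
  -- contains both out-neighbours `c (i₀ + 1)` and `p 0` of `c i₀`. It is not functional, so it is
  -- everything.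
  · let q : ℕ → V := fun t => if t ≤ i₀ then c t else p (t - i₀ - 1)
    have hq : D.IsStrongOn (q '' Set.Iic (i₀ + k + 1)) := by
      apply isStrongOn_of_closedWalk
      · intro t ht
        simp only [q]
        rcases lt_trichotomy t i₀ with h | h | h
        · rw [if_pos h.le, if_pos (Nat.succ_le_of_lt h), hcadj]
        · subst h
          rw [if_pos le_rfl, if_neg (by omega), show t + 1 - t - 1 = 0 by omega]
          exact hup
        · rw [if_neg (by omega), if_neg (by omega), show t + 1 - i₀ - 1 = t - i₀ - 1 + 1 by omega]
          exact hpadj _ (by omega)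
      · simp only [q]
        rw [if_neg (by omega), if_pos (by omega), show i₀ + k + 1 - i₀ - 1 = k by omega, hc0]
        exact hpw
    have hS := hCs.union hq (hcC 0) ⟨0, Nat.zero_le _, by simp [q]⟩
    have hSu : C ∪ q '' Set.Iic (i₀ + k + 1) = Set.univ := by
      by_contra hne
      refine hcp (i₀ + 1) 0 (by omega) (hprop _ hne hS (c i₀) (Or.inl (hcC _)) _
        (Or.inl (hcC _)) _ (Or.inr ⟨i₀ + 1, ?_, ?_⟩) ((hcadj _ _).2 rfl) hup)
      · simp only [Set.mem_Iic]; omega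
      · simp [q]
    intro v
    have hv : v ∈ C ∪ q '' Set.Iic (i₀ + k + 1) := hSu ▸ Set.mem_univ v
    rcases hv with hv | ⟨t, ht, rfl⟩
    · exact Or.inl (hccov v hv)
    · simp only [Set.mem_Iic] at ht
      simp only [q]
      split_ifs with h
      · exact Or.inl ⟨t, by omega, rfl⟩
      · exact Or.inr ⟨_, by omega, rfl⟩
  · intro i hi j hj h
    by_contra hne
    rcases Nat.lt_or_gt_of_ne hne with hlt | hlt
    · exact hpinj i j hlt hj h
    · exact hpinj j i hlt hi h.symm

end Digraph

/-! ### Arcs that minimality permits -/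

namespace Digraph

open Relation

variable {V : Type*} {D : Digraph V} {m k : ℕ} {c p : ℕ → V}

/-- The vertices of the cycle, followed by those of the ear. -/
def cycleThenEar (m : ℕ) (c p : ℕ → V) (i : ℕ) : V := if i < m then c i else p (i - m)

theorem cycleThenEar_of_lt {i : ℕ} (h : i < m) : cycleThenEar m c p i = c i := if_pos h

theorem cycleThenEar_of_le {i : ℕ} (h : m ≤ i) : cycleThenEar m c p i = p (i - m) :=
  if_neg h.not_gt

namespace IsEarEnumeration

variable (h : D.IsEarEnumeration m k c p)
include h

theorem c_inj {i j : ℕ} (hi : i < m) (hj : j < m) (hij : c i = c j) : i = j := by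
  have := (h.c_eq i j).1 hij
  unfold Nat.ModEq at this
  rwa [Nat.mod_eq_of_lt hi, Nat.mod_eq_of_lt hj] at this

theorem c_adj_iff {i j : ℕ} (hi : i < m) (hj : j < m) :
    D.Adj (c i) (c j) ↔ j = i + 1 ∨ (i + 1 = m ∧ j = 0) :=
  (h.c_adj i j).trans (modEq_succ_iff hi hj)

theorem cycleThenEar_inj {i j : ℕ} (hi : i < m + k + 1) (hj : j < m + k + 1)
    (hij : cycleThenEar m c p i = cycleThenEar m c p j) : i = j := by
  rcases Nat.lt_or_ge i m with him | him <;> rcases Nat.lt_or_ge j m with hjm | hjm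
  · rw [cycleThenEar_of_lt him, cycleThenEar_of_lt hjm] at hij
    exact h.c_inj him hjm hij
  · rw [cycleThenEar_of_lt him, cycleThenEar_of_le hjm] at hij
    exact absurd hij (h.c_ne_p _ _ (by omega))
  · rw [cycleThenEar_of_le him, cycleThenEar_of_lt hjm] at hij
    exact absurd hij.symm (h.c_ne_p _ _ (by omega))
  · rw [cycleThenEar_of_le him, cycleThenEar_of_le hjm] at hij
    have := h.p_inj _ (by omega) _ (by omega) hij
    omega

theorem card_eq : Nat.card V = m + k + 1 := by
  have hbij : Function.Bijective fun i : Fin (m + k + 1) => cycleThenEar m c p i := by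
    refine ⟨fun i j hij => Fin.ext (h.cycleThenEar_inj i.2 j.2 hij), fun v => ?_⟩
    rcases h.cover v with ⟨i, hi, rfl⟩ | ⟨i, hi, rfl⟩
    · exact ⟨⟨i, by omega⟩, cycleThenEar_of_lt hi⟩
    · refine ⟨⟨m + i, by omega⟩, ?_⟩
      simp only
      rw [cycleThenEar_of_le (by omega), Nat.add_sub_cancel_left]
  rw [← Nat.card_eq_of_bijective _ hbij, Nat.card_eq_fintype_card, Fintype.card_fin]

/-- A single entry or exit is encoded by `i₀ = i₁` or `j₀ = j₁`. -/
theorem adj_iff_earArc {i₀ i₁ j₀ j₁ : ℕ} (hi₀ : i₀ < m) (hi₁ : i₁ < m) (hj₀ : j₀ < m)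
    (hj₁ : j₁ < m) (hback : ∀ i ≤ k, ∀ j ≤ k, D.Adj (p i) (p j) → j = i + 1)
    (hU : ∀ i < m, D.Adj (c i) (p 0) ↔ i = i₀ ∨ i = i₁)
    (hW : ∀ j < m, D.Adj (p k) (c j) ↔ j = j₀ ∨ j = j₁) {i j : ℕ} (hi : i < m + k + 1)
    (hj : j < m + k + 1) :
    D.Adj (cycleThenEar m c p i) (cycleThenEar m c p j) ↔ EarArc m k i₀ i₁ j₀ j₁ i j := by
  unfold EarArc
  rcases Nat.lt_or_ge i m with him | him <;> rcases Nat.lt_or_ge j m with hjm | hjm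
  · rw [cycleThenEar_of_lt him, cycleThenEar_of_lt hjm, h.c_adj_iff him hjm]
    omega
  · rw [cycleThenEar_of_lt him, cycleThenEar_of_le hjm]
    have h1 : D.Adj (c i) (p (j - m)) ↔ j = m ∧ D.Adj (c i) (p 0) := by
      constructor
      · intro hadj
        have h0 := h.c_p i _ (by omega) hadj
        rw [h0] at hadj
        exact ⟨by omega, hadj⟩
      · rintro ⟨rfl, hadj⟩
        rwa [Nat.sub_self]
    rw [h1, hU i him]
    omega
  · rw [cycleThenEar_of_le him, cycleThenEar_of_lt hjm]
    have h1 : D.Adj (p (i - m)) (c j) ↔ i = m + k ∧ D.Adj (p k) (c j) := by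
      constructor
      · intro hadj
        have h0 := h.p_c _ (by omega) j hadj
        rw [h0] at hadj
        exact ⟨by omega, hadj⟩
      · rintro ⟨rfl, hadj⟩
        rwa [Nat.add_sub_cancel_left]
    rw [h1, hW j hjm]
    omega
  · rw [cycleThenEar_of_le him, cycleThenEar_of_le hjm]
    have h1 : D.Adj (p (i - m)) (p (j - m)) ↔ j = i + 1 := by
      constructor
      · intro hadj
        have := hback _ (by omega) _ (by omega) hadj
        omega
      · rintro rfl
        rw [show i + 1 - m = i - m + 1 by omega]
        exact h.p_adj _ (by omega)
    rw [h1]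
    omega

theorem isoTo_of_renumbers [Finite V] {i₀ i₁ j₀ j₁ : ℕ} {R : ℕ → ℕ → Prop} (hi₀ : i₀ < m)
    (hi₁ : i₁ < m) (hj₀ : j₀ < m) (hj₁ : j₁ < m)
    (hback : ∀ i ≤ k, ∀ j ≤ k, D.Adj (p i) (p j) → j = i + 1)
    (hU : ∀ i < m, D.Adj (c i) (p 0) ↔ i = i₀ ∨ i = i₁)
    (hW : ∀ j < m, D.Adj (p k) (c j) ↔ j = j₀ ∨ j = j₁)
    (hR : Renumbers (m + k + 1) (EarArc m k i₀ i₁ j₀ j₁) R) : D.IsoTo (m + k + 1) R := by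
  obtain ⟨σ, hσ, hσinj, hσR⟩ := hR
  refine isoTo_of_injective h.card_eq (fun x => cycleThenEar m c p (σ x)) ?_ ?_
  · intro x y hx hxn hy hyn hxy
    exact hσinj x y hx hxn hy hyn (h.cycleThenEar_inj (hσ x hx hxn) (hσ y hy hyn) hxy)
  · intro x y hx hxn hy hyn
    rw [h.adj_iff_earArc hi₀ hi₁ hj₀ hj₁ hback hU hW (hσ x hx hxn) (hσ y hy hyn)]
    exact hσR x y hx hxn hy hyn

theorem c_add_period (i : ℕ) : c (i + m) = c i := (h.c_eq _ _).2 (by simp [Nat.ModEq])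

/-- A cycle formed by the ear and a part of the cycle `c` is induced. -/
theorem functional_of_arc (hprop : ∀ T : Set V, T ≠ Set.univ → D.IsStrongOn T →
    D.IsFunctionalOn T) {a L : ℕ} (hL : L + 1 < m) (ha : D.Adj (p k) (c a))
    (haL : D.Adj (c (a + L)) (p 0)) :
    (∀ t < L, ¬D.Adj (c (a + t)) (p 0)) ∧ (∀ t, 0 < t → t ≤ L → ¬D.Adj (p k) (c (a + t))) ∧
      ∀ i ≤ k, ∀ j ≤ k, D.Adj (p i) (p j) → j = i + 1 := by
  let q : ℕ → V := fun t => if t ≤ L then c (a + t) else p (t - L - 1)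
  have hq : D.IsStrongOn (q '' Set.Iic (L + k + 1)) := by
    apply isStrongOn_of_closedWalk
    · intro t ht
      simp only [q]
      rcases lt_trichotomy t L with hlt | rfl | hlt
      · rw [if_pos hlt.le, if_pos (Nat.succ_le_of_lt hlt), h.c_adj]
        rfl
      · rw [if_pos le_rfl, if_neg (by omega), show t + 1 - t - 1 = 0 by omega]
        exact haL
      · rw [if_neg (by omega), if_neg (by omega), show t + 1 - L - 1 = t - L - 1 + 1 by omega]
        exact h.p_adj _ (by omega)
    · simp only [q]
      rw [if_neg (by omega), if_pos (by omega), show L + k + 1 - L - 1 = k by omega]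
      exact ha
  have hcmem : ∀ t ≤ L, c (a + t) ∈ q '' Set.Iic (L + k + 1) := fun t ht =>
    ⟨t, by simp only [Set.mem_Iic]; omega, if_pos ht⟩
  have hpmem : ∀ t ≤ k, p t ∈ q '' Set.Iic (L + k + 1) := fun t ht =>
    ⟨L + 1 + t, by simp only [Set.mem_Iic]; omega, by
      simp only [q]
      rw [if_neg (by omega), show L + 1 + t - L - 1 = t by omega]⟩
  -- The bound `L + 1 < m` leaves `c (a + L + 1)` off the walk, so its vertex set is proper and
  -- hence functional. The three claims say that no vertex on it has a second out-neighbour there.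
  have hne : q '' Set.Iic (L + k + 1) ≠ Set.univ := by
    intro huniv
    obtain ⟨t, ht, hqt⟩ : c (a + (L + 1)) ∈ q '' Set.Iic (L + k + 1) := huniv ▸ Set.mem_univ _
    simp only [Set.mem_Iic] at ht
    simp only [q] at hqt
    split_ifs at hqt with htL
    · have h1 := Nat.ModEq.add_left_cancel' a ((h.c_eq _ _).1 hqt)
      unfold Nat.ModEq at h1
      rw [Nat.mod_eq_of_lt (by omega), Nat.mod_eq_of_lt (by omega)] at h1
      omega
    · exact h.c_ne_p _ _ (by omega) hqt.symm
  have hf := hprop _ hne hq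
  refine ⟨fun t ht hadj => ?_, fun t ht0 htL hadj => ?_, fun i hi j hj hij => ?_⟩
  · exact h.c_ne_p _ 0 (by omega) (hf _ (hcmem t ht.le) _ (hcmem (t + 1) ht) _ (hpmem 0 (by omega))
      ((h.c_adj _ _).2 rfl) hadj)
  · have h0 := hf _ (hpmem k le_rfl) _ (hcmem 0 (by omega)) _ (hcmem t htL) ha hadj
    have h1 := Nat.ModEq.add_left_cancel' a ((h.c_eq _ _).1 h0)
    unfold Nat.ModEq at h1
    rw [Nat.mod_eq_of_lt (by omega), Nat.mod_eq_of_lt (by omega)] at h1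
    omega
  · rcases hi.lt_or_eq with hik | rfl
    · exact h.p_inj _ hj _ hik
        (hf _ (hpmem i hi) _ (hpmem j hj) _ (hpmem (i + 1) hik) hij (h.p_adj i hik))
    · exact absurd (hf _ (hpmem i hi) _ (hcmem 0 (by omega)) _ (hpmem j hj) ha hij)
        (h.c_ne_p _ _ hj)

/-- Overlapping back arcs of the ear are excluded. -/
theorem back_arcs_disjoint (hprop : ∀ T : Set V, T ≠ Set.univ → D.IsStrongOn T →
    D.IsFunctionalOn T) {a b a' b' : ℕ} (hba : b < a) (hak : a ≤ k) (hba' : b' < a')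
    (hak' : a' ≤ k) (hab : D.Adj (p a) (p b)) (hab' : D.Adj (p a') (p b')) (hle : a ≤ a')
    (hov : b' ≤ a) : a = a' ∧ b = b' := by
  have hint : ∀ a b, b < a → a ≤ k → D.Adj (p a) (p b) →
      D.IsStrongOn ((fun t => p (b + t)) '' Set.Iic (a - b)) := by
    intro a b hba hak hab
    apply isStrongOn_of_closedWalk
    · exact fun t ht => h.p_adj (b + t) (by omega)
    · simpa [Nat.add_sub_cancel' hba.le] using hab
  have hmem : ∀ a b t, b ≤ t → t ≤ a → p t ∈ (fun t => p (b + t)) '' Set.Iic (a - b) := by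
    intro a b t h1 h2
    refine ⟨t - b, by simp only [Set.mem_Iic]; omega, ?_⟩
    simp only
    rw [Nat.add_sub_cancel' h1]
  -- Overlapping intervals have a strongly connected union, which misses `c 0` and so is functional.
  -- But `p a` would have the successors `p b` and `p (a + 1)` if `a < a'`, or `p b` and `p b'` if
  -- `a = a'`.
  have hS := (hint a b hba hak hab).union (hint a' b' hba' hak' hab')
    (hmem a b a hba.le le_rfl) (hmem a' b' a hov hle)
  have hne : (fun t => p (b + t)) '' Set.Iic (a - b) ∪ (fun t => p (b' + t)) '' Set.Iic (a' - b') ≠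
      Set.univ := by
    intro huniv
    have h0 : c 0 ∈ (fun t => p (b + t)) '' Set.Iic (a - b) ∪
      (fun t => p (b' + t)) '' Set.Iic (a' - b') := huniv ▸ Set.mem_univ _
    rcases h0 with ⟨t, ht, h1⟩ | ⟨t, ht, h1⟩ <;> simp only [Set.mem_Iic] at ht
    · exact h.c_ne_p 0 (b + t) (by omega) h1.symm
    · exact h.c_ne_p 0 (b' + t) (by omega) h1.symm
  have hf := hprop _ hne hS
  rcases hle.lt_or_eq with hlt | rfl
  · have := h.p_inj _ (by omega) _ (by omega) (hf _ (Or.inl (hmem a b a hba.le le_rfl)) _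
      (Or.inl (hmem a b b le_rfl hba.le)) _ (Or.inr (hmem a' b' (a + 1) (by omega) (by omega)))
      hab (h.p_adj a (by omega)))
    omega
  · exact ⟨rfl, h.p_inj _ (by omega) _ (by omega) (hf _ (Or.inl (hmem a b a hba.le le_rfl)) _
      (Or.inl (hmem a b b le_rfl hba.le)) _ (Or.inr (hmem a b' b' le_rfl hba'.le)) hab hab')⟩

end IsEarEnumeration

end Digraph

/-! ### Classification into the seven types -/

namespace Digraph

open Relation

variable {V : Type*} {D : Digraph V}

theorem IsoTo.congr_card {n n' : ℕ} {R : ℕ → ℕ → Prop} (h : D.IsoTo n R) (hn : n = n') :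
    D.IsoTo n' R := hn ▸ h

/-- A set of arcs `(x, y)`, `y < x`, spanning pairwise disjoint intervals can be listed
increasingly. -/
theorem exists_interval_enumeration {n : ℕ} {B : ℕ → ℕ → Prop}
    (hB : ∀ x y, B x y → 1 ≤ y ∧ y < x ∧ x ≤ n)
    (hdisj : ∀ x y x' y', B x y → B x' y' → x < x' → x < y')
    (huniq : ∀ x y y', B x y → B x y' → y = y') :
    ∃ (l : ℕ) (a b : Fin l → ℕ), (∀ i, 1 ≤ b i ∧ b i < a i ∧ a i ≤ n) ∧
      (∀ i j, i < j → a i < b j) ∧ ∀ x y, B x y ↔ ∃ i, x = a i ∧ y = b i := by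
  classical
  let s : Finset ℕ := (Finset.range (n + 1)).filter fun x => ∃ y, B x y
  have hs : ∀ x, x ∈ s ↔ ∃ y, B x y := by
    intro x
    simp only [s, Finset.mem_filter, Finset.mem_range, and_iff_right_iff_imp]
    rintro ⟨y, hy⟩
    have := hB x y hy
    omega
  let a : Fin s.card → ℕ := s.orderEmbOfFin rfl
  have ha : ∀ i, ∃ y, B (a i) y := fun i => (hs _).1 (s.orderEmbOfFin_mem rfl i)
  choose b hb using ha
  refine ⟨s.card, a, b, fun i => hB _ _ (hb i), fun i j hij => hdisj _ _ _ _ (hb i) (hb j)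
    ((s.orderEmbOfFin rfl).strictMono hij), fun x y => ⟨fun hxy => ?_, ?_⟩⟩
  · have hx : x ∈ Set.range (s.orderEmbOfFin rfl) := by
      rw [Finset.range_orderEmbOfFin]
      exact (hs x).2 ⟨y, hxy⟩
    obtain ⟨i, rfl⟩ := hx
    exact ⟨i, rfl, huniq _ _ _ hxy (hb i)⟩
  · rintro ⟨i, rfl, rfl⟩
    exact hb i

namespace IsEarEnumeration

variable {m k : ℕ} {c p : ℕ → V} (h : D.IsEarEnumeration m k c p)
include h

/-- The only entry is the last cycle vertex and the only exit the first, so cycle and ear together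
form a Hamiltonian cycle. The additional arcs are the closing arc of the original cycle and the back
arcs of the ear, at least one of which exists. -/
theorem isType4 [Finite V] (hloop : ∀ v, ¬D.Adj v v)
    (hprop : ∀ T : Set V, T ≠ Set.univ → D.IsStrongOn T → D.IsFunctionalOn T)
    (hU : ∀ i < m, D.Adj (c i) (p 0) ↔ i + 1 = m) (hW : ∀ j < m, D.Adj (p k) (c j) ↔ j = 0)
    (hback : ¬∀ i ≤ k, ∀ j ≤ k, D.Adj (p i) (p j) → j = i + 1) : D.IsType4 := by
  push Not at hback
  obtain ⟨s, hs, t, ht, hst, hne⟩ := hback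
  have hts : t < s := by
    have h1 := h.p_p s hs t ht hst
    have h2 : t ≠ s := by rintro rfl; exact hloop _ hst
    omega
  have hm := h.two_le
  -- Numbers start at `1`: `c i` is `i + 1` and `p i` is `m + 1 + i`, so `(m, 1)` is the arc closing
  -- the original cycle.
  let B : ℕ → ℕ → Prop := fun x y => (x = m ∧ y = 1) ∨
    (m < y ∧ y < x ∧ x ≤ m + k + 1 ∧ D.Adj (p (x - m - 1)) (p (y - m - 1)))
  obtain ⟨l, a, b, hab, habd, hBab⟩ := exists_interval_enumeration (n := m + k + 1) (B := B)
    (by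
      rintro x y (⟨rfl, rfl⟩ | ⟨h1, h2, h3, -⟩)
      · omega
      · omega)
    (by
      rintro x y x' y' (⟨rfl, rfl⟩ | ⟨h1, h2, h3, h4⟩) (⟨rfl, rfl⟩ | ⟨h1', h2', h3', h4'⟩) hlt
      · omega
      · omega
      · omega
      · by_contra hle
        have := h.back_arcs_disjoint hprop (by omega) (by omega) (by omega) (by omega) h4 h4'
          (by omega) (by omega)
        omega)
    (by
      rintro x y y' (⟨rfl, rfl⟩ | ⟨h1, h2, h3, h4⟩) (⟨h0, rfl⟩ | ⟨h1', h2', h3', h4'⟩)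
      · rfl
      · omega
      · omega
      · have := h.back_arcs_disjoint hprop (by omega) (by omega) (by omega) (by omega) h4 h4'
          le_rfl (by omega)
        omega)
  obtain ⟨i₁, hi₁, -⟩ := (hBab m 1).1 (Or.inl ⟨rfl, rfl⟩)
  obtain ⟨i₂, hi₂, -⟩ := (hBab (m + 1 + s) (m + 1 + t)).1 (Or.inr ⟨by omega, by omega, by omega, by
    rwa [show m + 1 + s - m - 1 = s by omega, show m + 1 + t - m - 1 = t by omega]⟩)
  have hl : 2 ≤ l := by
    have h12 : i₁ ≠ i₂ := by rintro rfl; omega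
    have := Fin.val_ne_of_ne h12
    omega
  refine ⟨m + k + 1, l, a, b, hl, hab, habd, isoTo_of_injective h.card_eq
    (fun x => cycleThenEar m c p (x - 1)) ?_ ?_⟩
  · intro x y hx hxn hy hyn hxy
    have := h.cycleThenEar_inj (by omega) (by omega) hxy
    omega
  · intro x y hx hxn hy hyn
    rw [← hBab]
    unfold CycleArc
    simp only [B]
    rcases Nat.lt_or_ge (x - 1) m with hxm | hxm <;> rcases Nat.lt_or_ge (y - 1) m with hym | hym
    · rw [cycleThenEar_of_lt hxm, cycleThenEar_of_lt hym, h.c_adj_iff hxm hym]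
      omega
    · rw [cycleThenEar_of_lt hxm, cycleThenEar_of_le hym]
      have h1 : D.Adj (c (x - 1)) (p (y - 1 - m)) ↔ y - 1 = m ∧ D.Adj (c (x - 1)) (p 0) := by
        constructor
        · intro hadj
          have h0 := h.c_p _ _ (by omega) hadj
          rw [h0] at hadj
          exact ⟨by omega, hadj⟩
        · rintro ⟨h0, hadj⟩
          rwa [h0, Nat.sub_self]
      rw [h1, hU _ hxm]
      omega
    · rw [cycleThenEar_of_le hxm, cycleThenEar_of_lt hym]
      have h1 : D.Adj (p (x - 1 - m)) (c (y - 1)) ↔ x - 1 = m + k ∧ D.Adj (p k) (c (y - 1)) := by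
        constructor
        · intro hadj
          have h0 := h.p_c _ (by omega) _ hadj
          rw [h0] at hadj
          exact ⟨by omega, hadj⟩
        · rintro ⟨h0, hadj⟩
          rwa [h0, Nat.add_sub_cancel_left]
      rw [h1, hW _ hym]
      omega
    · rw [cycleThenEar_of_le hxm, cycleThenEar_of_le hym, Nat.sub_right_comm x 1 m,
        Nat.sub_right_comm y 1 m]
      constructor
      · intro hadj
        have h1 := h.p_p _ (by omega) _ (by omega) hadj
        have h2 : y ≠ x := by rintro rfl; exact hloop _ hadj
        by_cases hyx : y = x + 1
        · exact Or.inl (Or.inl hyx)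
        · exact Or.inr (Or.inr ⟨by omega, by omega, by omega, hadj⟩)
      · rintro ((rfl | ⟨rfl, rfl⟩) | ⟨rfl, rfl⟩ | ⟨-, -, -, hadj⟩)
        · rw [show x + 1 - m - 1 = x - m - 1 + 1 by omega]
          exact h.p_adj _ (by omega)
        · omega
        · omega
        · exact hadj

/-- The position of the first entry `i₀` decides. If `i₀ + 1 < m`, the segment from `0` to `i₀` and
the ear form an induced cycle; the only possible further entry is `m - 1`, the only further exit `i₀
+ 1`, and back arcs are impossible. If `i₀ = m - 1`, there is at most one exit besides `0`, and back
arcs can occur only if there is none. -/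
theorem isOneOfSevenTypes [Finite V] (hloop : ∀ v, ¬D.Adj v v)
    (hprop : ∀ T : Set V, T ≠ Set.univ → D.IsStrongOn T → D.IsFunctionalOn T) :
    D.IsOneOfSevenTypes := by
  classical
  have hm := h.two_le
  have hexit := h.exit
  obtain ⟨hi₀m, hi₀⟩ := Nat.find_spec h.entry
  have hmin : ∀ i, i < Nat.find h.entry → i < m → ¬D.Adj (c i) (p 0) :=
    fun i hi him hadj => Nat.find_min h.entry hi ⟨him, hadj⟩
  generalize Nat.find h.entry = i₀ at hi₀m hi₀ hmin
  rcases Nat.lt_or_ge (i₀ + 1) m with hlt | hge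
  · obtain ⟨-, hWlow, hback⟩ := h.functional_of_arc hprop (a := 0) hlt hexit (by rwa [zero_add])
    have hU : ∀ i < m, D.Adj (c i) (p 0) → i = i₀ ∨ i + 1 = m := by
      intro i him hadj
      by_contra! hne
      rcases Nat.lt_or_gt_of_ne hne.1 with hi | hi
      · exact hmin i hi him hadj
      · exact (h.functional_of_arc hprop (a := 0) (L := i) (by omega) hexit
          (by rwa [zero_add])).1 i₀ hi (by rwa [zero_add])
    have hW : ∀ j < m, D.Adj (p k) (c j) → j = 0 ∨ j = i₀ + 1 := by
      intro j hjm hadj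
      by_contra! hne
      rcases Nat.lt_or_ge i₀ j with hj | hj
      -- An exit `j > i₀ + 1` closes a walk that runs from `j` around past `0` to `i₀`; on it the
      -- exit `0` comes too late.
      · refine (h.functional_of_arc hprop (a := j) (L := i₀ + m - j) (by omega) hadj ?_).2.1
          (m - j) (by omega) (by omega) ?_
        · rwa [show j + (i₀ + m - j) = i₀ + m by omega, h.c_add_period]
        · rwa [show j + (m - j) = 0 + m by omega, h.c_add_period]
      · exact hWlow j (by omega) hj (by rwa [zero_add])
    by_cases hlast : D.Adj (c (m - 1)) (p 0) <;> by_cases hnext : D.Adj (p k) (c (i₀ + 1))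
    · have hU' : ∀ i < m, D.Adj (c i) (p 0) ↔ i = i₀ ∨ i = m - 1 := by
        refine fun i him => ⟨fun hadj => ?_, by rintro (rfl | rfl) <;> assumption⟩
        have := hU i him hadj
        omega
      have hW' : ∀ j < m, D.Adj (p k) (c j) ↔ j = 0 ∨ j = i₀ + 1 :=
        fun j hjm => ⟨hW j hjm, by rintro (rfl | rfl) <;> assumption⟩
      have iso := fun {R} => h.isoTo_of_renumbers (R := R) hi₀m (by omega) (by omega) hlt hback
        hU' hW'
      rcases Nat.eq_zero_or_pos i₀ with rfl | hpos
      · obtain ⟨r, rfl⟩ : ∃ r, m = r + 2 := ⟨m - 2, by omega⟩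
        exact Or.inr (Or.inr (Or.inr (Or.inl ⟨r + 2, k + 2, by omega, by omega,
          (iso (renumbers_type2 r k)).congr_card (by omega)⟩)))
      by_cases hlast' : i₀ + 2 = m
      · subst hlast'
        exact Or.inr (Or.inr (Or.inr (Or.inl ⟨i₀ + 2, k + 2, by omega, by omega,
          (iso (renumbers_type2_of_last i₀ k)).congr_card (by omega)⟩)))
      rcases k with _ | l
      · obtain ⟨d, rfl⟩ : ∃ d, m = i₀ + d + 2 := ⟨m - i₀ - 2, by omega⟩
        exact Or.inr (Or.inr (Or.inr (Or.inl ⟨i₀ + 2, d + 2, by omega, by omega,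
          (iso (renumbers_type2_of_short i₀ d)).congr_card (by omega)⟩)))
      · obtain ⟨r, rfl⟩ : ∃ r, i₀ = r + 1 := ⟨i₀ - 1, by omega⟩
        obtain ⟨d, rfl⟩ : ∃ d, m = r + d + 4 := ⟨m - r - 4, by omega⟩
        exact Or.inr (Or.inr (Or.inr (Or.inr (Or.inr (Or.inr ⟨_, d + 4, d + l + 6, by omega,
          by omega, by omega, iso (renumbers_type5 r d l)⟩)))))
    · have hU' : ∀ i < m, D.Adj (c i) (p 0) ↔ i = i₀ ∨ i = m - 1 := by
        refine fun i him => ⟨fun hadj => ?_, by rintro (rfl | rfl) <;> assumption⟩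
        have := hU i him hadj
        omega
      have hW' : ∀ j < m, D.Adj (p k) (c j) ↔ j = 0 ∨ j = 0 := by
        refine fun j hjm => ⟨fun hadj => ?_, by rintro (rfl | rfl) <;> assumption⟩
        have h1 := hW j hjm hadj
        have h2 : j ≠ i₀ + 1 := by rintro rfl; exact hnext hadj
        omega
      have iso := fun {R} => h.isoTo_of_renumbers (R := R) hi₀m (by omega) (by omega) (by omega)
        hback hU' hW'
      rcases Nat.eq_zero_or_pos i₀ with rfl | hpos
      · obtain ⟨r, rfl⟩ : ∃ r, m = r + 2 := ⟨m - 2, by omega⟩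
        exact Or.inr (Or.inr (Or.inl ⟨r + 2, k + 2, by omega, by omega,
          (iso (renumbers_type1 r k)).congr_card (by omega)⟩))
      · obtain ⟨r, rfl⟩ : ∃ r, i₀ = r + 1 := ⟨i₀ - 1, by omega⟩
        obtain ⟨e, rfl⟩ : ∃ e, m = r + e + 3 := ⟨m - r - 3, by omega⟩
        exact Or.inr (Or.inr (Or.inr (Or.inr (Or.inl ⟨_, e + 3, e + k + 4, by omega,
          by omega, by omega, iso (renumbers_type3 r e k)⟩))))
    · have hU' : ∀ i < m, D.Adj (c i) (p 0) ↔ i = i₀ ∨ i = i₀ := by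
        refine fun i him => ⟨fun hadj => ?_, by rintro (rfl | rfl) <;> assumption⟩
        have h1 := hU i him hadj
        have h2 : i ≠ m - 1 := by rintro rfl; exact hlast hadj
        omega
      have hW' : ∀ j < m, D.Adj (p k) (c j) ↔ j = 0 ∨ j = i₀ + 1 :=
        fun j hjm => ⟨hW j hjm, by rintro (rfl | rfl) <;> assumption⟩
      have iso := fun {R} => h.isoTo_of_renumbers (R := R) hi₀m hi₀m (by omega) hlt hback hU' hW'
      rcases Nat.eq_zero_or_pos i₀ with rfl | hpos
      · obtain ⟨r, rfl⟩ : ∃ r, m = r + 2 := ⟨m - 2, by omega⟩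
        exact Or.inr (Or.inr (Or.inl ⟨k + 2, r + 2, by omega, by omega,
          (iso (renumbers_type1_of_first r k)).congr_card (by omega)⟩))
      · obtain ⟨r, rfl⟩ : ∃ r, i₀ = r + 1 := ⟨i₀ - 1, by omega⟩
        obtain ⟨e, rfl⟩ : ∃ e, m = r + e + 3 := ⟨m - r - 3, by omega⟩
        exact Or.inr (Or.inr (Or.inr (Or.inr (Or.inl ⟨_, k + 3, k + e + 4, by omega,
          by omega, by omega, iso (renumbers_type3_of_first r e k)⟩))))
    · have hU' : ∀ i < m, D.Adj (c i) (p 0) ↔ i = i₀ ∨ i = i₀ := by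
        refine fun i him => ⟨fun hadj => ?_, by rintro (rfl | rfl) <;> assumption⟩
        have h1 := hU i him hadj
        have h2 : i ≠ m - 1 := by rintro rfl; exact hlast hadj
        omega
      have hW' : ∀ j < m, D.Adj (p k) (c j) ↔ j = 0 ∨ j = 0 := by
        refine fun j hjm => ⟨fun hadj => ?_, by rintro (rfl | rfl) <;> assumption⟩
        have h1 := hW j hjm hadj
        have h2 : j ≠ i₀ + 1 := by rintro rfl; exact hnext hadj
        omega
      have iso := fun {R} => h.isoTo_of_renumbers (R := R) hi₀m hi₀m (by omega) (by omega) hback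
        hU' hW'
      rcases Nat.eq_zero_or_pos i₀ with rfl | hpos
      · exact Or.inl ⟨m, k + 2, by omega, by omega,
          (iso (renumbers_infty m k hm)).congr_card (by omega)⟩
      · obtain ⟨r, rfl⟩ : ∃ r, i₀ = r + 1 := ⟨i₀ - 1, by omega⟩
        obtain ⟨a, rfl⟩ : ∃ a, m = a + r + 2 := ⟨m - r - 2, by omega⟩
        rcases Nat.le_total a (k + 1) with hak | hak
        · exact Or.inr (Or.inl ⟨a, k + 1, r, hak, by omega,
            (iso (renumbers_theta a k r)).congr_card (by omega)⟩)
        · exact Or.inr (Or.inl ⟨k + 1, a, r, hak, by omega,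
            (iso (renumbers_theta_swap a k r hak)).congr_card (by omega)⟩)
  · have hi₀' : i₀ = m - 1 := by omega
    subst hi₀'
    have hU : ∀ i < m, D.Adj (c i) (p 0) ↔ i = m - 1 ∨ i = m - 1 := by
      refine fun i him => ⟨fun hadj => ?_, by rintro (rfl | rfl) <;> assumption⟩
      by_contra hne
      exact hmin i (by omega) him hadj
    by_cases hWne : ∃ j, 0 < j ∧ j < m ∧ D.Adj (p k) (c j)
    · obtain ⟨j, hj0, hjm, hj⟩ := hWne
      -- The segment from `j > 0` to the only entry `m - 1` omits `0`, so no exit follows `j` on it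
      -- and the ear has no back arcs.
      have harc : ∀ j, 0 < j → j < m → D.Adj (p k) (c j) →
          (∀ t, 0 < t → t ≤ m - 1 - j → ¬D.Adj (p k) (c (j + t))) ∧
            ∀ i ≤ k, ∀ j ≤ k, D.Adj (p i) (p j) → j = i + 1 := by
        intro j hj0 hjm hj
        exact (h.functional_of_arc hprop (a := j) (L := m - 1 - j) (by omega) hj
          (by rwa [show j + (m - 1 - j) = m - 1 by omega])).2
      have hW : ∀ j' < m, D.Adj (p k) (c j') ↔ j' = 0 ∨ j' = j := by
        refine fun j' hj'm => ⟨fun hadj => ?_, by rintro (rfl | rfl) <;> assumption⟩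
        by_contra! hne
        rcases Nat.lt_or_gt_of_ne hne.2 with hlt | hlt
        · exact (harc j' (by omega) hj'm hadj).1 (j - j') (by omega) (by omega)
            (by rwa [Nat.add_sub_cancel' hlt.le])
        · exact (harc j hj0 hjm hj).1 (j' - j) (by omega) (by omega)
            (by rwa [Nat.add_sub_cancel' hlt.le])
      have iso := fun {R} => h.isoTo_of_renumbers (R := R) hi₀m hi₀m (by omega) hjm
        (harc j hj0 hjm hj).2 hU hW
      by_cases hjlast : j + 1 = m
      · obtain ⟨r, rfl⟩ : ∃ r, j = r + 1 := ⟨j - 1, by omega⟩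
        subst hjlast
        exact Or.inr (Or.inr (Or.inl ⟨k + 2, r + 2, by omega, by omega,
          (iso (renumbers_type1_of_last r k)).congr_card (by omega)⟩))
      · obtain ⟨r, rfl⟩ : ∃ r, j = r + 1 := ⟨j - 1, by omega⟩
        obtain ⟨e, rfl⟩ : ∃ e, m = r + e + 3 := ⟨m - r - 3, by omega⟩
        exact Or.inr (Or.inr (Or.inr (Or.inr (Or.inl ⟨_, k + 3, k + r + 4, by omega,
          by omega, by omega, iso (renumbers_type3_of_last r e k)⟩))))
    · push Not at hWne
      have hW : ∀ j < m, D.Adj (p k) (c j) ↔ j = 0 ∨ j = 0 := by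
        refine fun j hjm => ⟨fun hadj => ?_, by rintro (rfl | rfl) <;> assumption⟩
        by_contra hne
        exact hWne j (by omega) hjm hadj
      by_cases hback : ∀ i ≤ k, ∀ j ≤ k, D.Adj (p i) (p j) → j = i + 1
      · have iso := fun {R} => h.isoTo_of_renumbers (R := R) hi₀m hi₀m (by omega) (by omega) hback
          hU hW
        -- A `θ`-digraph with `a = 0`: the arc from `c (m - 1)` to `c 0` is the path without inner
        -- vertices.
        obtain ⟨r, rfl⟩ : ∃ r, m = 0 + r + 2 := ⟨m - 2, by omega⟩
        exact Or.inr (Or.inl ⟨0, k + 1, r, by omega, by omega,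
          (iso (by
            have := renumbers_theta 0 k r
            rwa [show r + 1 = 0 + r + 2 - 1 by omega] at this)).congr_card (by omega)⟩)
      · exact Or.inr (Or.inr (Or.inr (Or.inr (Or.inr (Or.inl (h.isType4 hloop hprop
          (fun i him => (hU i him).trans (by omega)) (fun j hjm => (hW j hjm).trans (by omega))
          hback))))))

end IsEarEnumeration

/-- Strongly connected digraphs that are neither a vertex nor a cycle, but all of whose proper
strongly connected induced subdigraphs are. -/
theorem isOneOfSevenTypes_of_minimal [Finite V] [Nonempty V] (hloop : ∀ v, ¬D.Adj v v)
    (hD : D.IsStrongOn Set.univ) (hnf : ¬D.IsFunctionalOn Set.univ)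
    (hprop : ∀ T : Set V, T ≠ Set.univ → D.IsStrongOn T → D.IsFunctionalOn T) :
    D.IsOneOfSevenTypes := by
  obtain ⟨m, k, c, p, h⟩ := exists_isEarEnumeration hloop hD hnf hprop
  exact h.isOneOfSevenTypes hloop hprop

/-! ### Consequences of having three eigenvalues -/

theorem IsoTo.not_functional {n : ℕ} {R : ℕ → ℕ → Prop} (h : D.IsoTo n R) {x y z : ℕ}
    (hx : x ∈ Set.Icc 1 n) (hy : y ∈ Set.Icc 1 n) (hz : z ∈ Set.Icc 1 n) (hyz : y ≠ z)
    (hxy : R x y) (hxz : R x z) : ¬D.IsFunctionalOn Set.univ := by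
  obtain ⟨e, he⟩ := h
  intro hf
  have := hf (e.symm ⟨x, hx⟩) trivial (e.symm ⟨y, hy⟩) trivial (e.symm ⟨z, hz⟩) trivial
    (by rw [he]; simpa using hxy) (by rw [he]; simpa using hxz)
  exact hyz (by simpa using this)

/-- Each type has a vertex with two out-neighbours, so a component of one of these types has Perron
value greater than `1`. -/
theorem IsOneOfSevenTypes.not_functional (h : D.IsOneOfSevenTypes) :
    ¬D.IsFunctionalOn Set.univ := by
  have hinfty : ∀ r s, 2 ≤ r → 2 ≤ s → InftyArc r s 1 2 ∧ InftyArc r s 1 (r + 1) := by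
    intro r s hr hs
    unfold InftyArc PathArc
    omega
  rcases h with ⟨r, s, hr, hs, e⟩ | ⟨a, b, c, hab, hb, e⟩ | ⟨r, s, hr, hs, e⟩ | ⟨r, s, hr, hs, e⟩ |
    ⟨n, i, j, hi, hij, hj, e⟩ | ⟨n, k, a, b, hk, hab, hd, e⟩ | ⟨n, i, j, hi, hij, hj, e⟩
  · exact e.not_functional (x := 1) (y := 2) (z := r + 1) ⟨by omega, by omega⟩ ⟨by omega, by omega⟩
      ⟨by omega, by omega⟩ (by omega) (hinfty r s hr hs).1 (hinfty r s hr hs).2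
  · refine e.not_functional (x := 1) (y := if a = 0 then 2 else 3) (z := a + 3)
      ⟨by omega, by omega⟩ ?_ ⟨by omega, by omega⟩ ?_ ?_ ?_
    · rw [Set.mem_Icc]; split_ifs <;> omega
    · split_ifs <;> omega
    · unfold ThetaArc PathArc
      split_ifs <;> omega
    · unfold ThetaArc PathArc
      omega
  · exact e.not_functional (x := 1) (y := 2) (z := r + 1) ⟨by omega, by omega⟩ ⟨by omega, by omega⟩
      ⟨by omega, by omega⟩ (by omega) (Or.inl (hinfty r s hr hs).1) (Or.inl (hinfty r s hr hs).2)
  · exact e.not_functional (x := 1) (y := 2) (z := r + 1) ⟨by omega, by omega⟩ ⟨by omega, by omega⟩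
      ⟨by omega, by omega⟩ (by omega) (Or.inl (hinfty r s hr hs).1) (Or.inl (hinfty r s hr hs).2)
  · exact e.not_functional (x := 1) (y := 2) (z := i) ⟨by omega, by omega⟩ ⟨by omega, by omega⟩
      ⟨by omega, by omega⟩ (by omega) (Or.inl (Or.inl rfl)) (Or.inr (Or.inl ⟨rfl, rfl⟩))
  -- Since `k ≥ 2`, the first interval ends before `n`, so the successor of its end is `a 0 + 1`
  -- without wrapping around.
  · have h0 := hab ⟨0, by omega⟩
    have h1 := hab ⟨1, by omega⟩
    have h01 := hd ⟨0, by omega⟩ ⟨1, by omega⟩ (by simp)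
    exact e.not_functional (x := a ⟨0, by omega⟩) (y := a ⟨0, by omega⟩ + 1)
      (z := b ⟨0, by omega⟩) ⟨by omega, by omega⟩ ⟨by omega, by omega⟩
      ⟨by omega, by omega⟩ (by omega) (Or.inl (Or.inl rfl)) (Or.inr ⟨_, rfl, rfl⟩)
  · exact e.not_functional (x := 1) (y := 2) (z := i) ⟨by omega, by omega⟩ ⟨by omega, by omega⟩
      ⟨by omega, by omega⟩ (by omega) (Or.inl (Or.inl rfl)) (Or.inr (Or.inl ⟨rfl, rfl⟩))

theorem isFunctionalOn_induced_univ_iff {S : Set V} :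
    (D.induced S).IsFunctionalOn Set.univ ↔ D.IsFunctionalOn S :=
  ⟨fun h x hx y hy z hz hxy hxz =>
    congrArg Subtype.val (h ⟨x, hx⟩ trivial ⟨y, hy⟩ trivial ⟨z, hz⟩ trivial hxy hxz),
    fun h x _ y _ z _ hxy hxz => Subtype.ext (h x x.2 y y.2 z z.2 hxy hxz)⟩

/-- With exactly three complementarity eigenvalues, these are `0`, `1` and the Perron value of any
strongly connected vertex set that is neither a vertex nor a cycle. -/
theorem complementaritySpectrum_eq_of_encard [Fintype V] (hloop : ∀ v, ¬D.Adj v v)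
    (hthree : D.complementaritySpectrum.encard = 3) {S : Set V} (hne : S.Nonempty)
    (hS : D.IsStrongOn S) (hnf : ¬D.IsFunctionalOn S) {μ : ℝ} {x : V → ℝ}
    (hx : D.IsPerronPair S μ x) : 1 < μ ∧ D.complementaritySpectrum = {0, 1, μ} := by
  obtain ⟨hμ, h1⟩ := hS.one_lt_of_not_functional hnf hx
  refine ⟨hμ, Eq.symm (Set.Finite.eq_of_subset_of_encard_le
    (Set.toFinite _) ?_ ?_)⟩
  · obtain ⟨v, -⟩ := id hne
    rintro _ (rfl | rfl | rfl)
    · exact (D.mem_complementaritySpectrum_iff 0).2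
        ⟨{v}, Set.singleton_nonempty v, _, isPerronPair_singleton (hloop v)⟩
    · exact h1
    · exact (D.mem_complementaritySpectrum_iff _).2 ⟨S, hne, x, hx⟩
  · rw [hthree]
    refine ge_of_eq (Set.encard_eq_three.2 ⟨0, 1, μ, by norm_num, ?_, ?_, rfl⟩) <;> linarith

end Digraph

theorem mainTheorem5 {V : Type*} [Finite V] (D : Digraph V) (hloop : ∀ v, ¬ D.Adj v v)
    (hthree : D.complementaritySpectrum.encard = 3) :
    (∀ S ∈ D.strongComponents, (D.induced S).IsIsolatedVertex ∨ (D.induced S).IsCycle ∨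
      (D.induced S).IsOneOfSevenTypes) ∧
    (∃ S ∈ D.strongComponents, (D.induced S).IsOneOfSevenTypes) ∧
    (∀ S ∈ D.strongComponents, ∀ T ∈ D.strongComponents,
      (D.induced S).IsOneOfSevenTypes → (D.induced T).IsOneOfSevenTypes →
      (D.induced S).specRadius = (D.induced T).specRadius) := by
  have := Fintype.ofFinite V
  have hstrong : ∀ S ∈ D.strongComponents, S.Nonempty ∧ D.IsStrongOn S := by
    rintro _ ⟨v, rfl⟩
    exact ⟨⟨v, D.mem_strongComponent_self v⟩, D.isStrongOn_strongComponent v⟩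
  have hloop' : ∀ S : Set V, ∀ v, ¬(D.induced S).Adj v v := fun S v => hloop v
  have hseven : ∀ S ∈ D.strongComponents, ¬D.IsFunctionalOn S →
      (D.induced S).IsOneOfSevenTypes := by
    intro S hS hnf
    obtain ⟨hne, hSs⟩ := hstrong S hS
    have := hne.to_subtype
    refine Digraph.isOneOfSevenTypes_of_minimal (hloop' S) hSs.induced_univ
      (mt Digraph.isFunctionalOn_induced_univ_iff.1 hnf) fun T hT hTs => ?_
    by_contra hTf
    have hTne : (Subtype.val '' T).Nonempty := by
      by_contra hemp
      rw [Set.image_nonempty, Set.not_nonempty_iff_eq_empty] at hemp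
      subst hemp
      exact hTf fun x hx => absurd hx (Set.notMem_empty x)
    have hTf' : ¬D.IsFunctionalOn (Subtype.val '' T) := fun hf => hTf fun x hx y hy z hz hxy hxz =>
      Subtype.ext (hf x ⟨x, hx, rfl⟩ y ⟨y, hy, rfl⟩ z ⟨z, hz, rfl⟩ hxy hxz)
    have hTS : Subtype.val '' T ⊂ S := by
      obtain ⟨s, hs⟩ := (Set.ne_univ_iff_exists_notMem T).1 hT
      refine (Set.ssubset_iff_of_subset (by rintro _ ⟨a, -, rfl⟩; exact a.2)).2 ⟨s, s.2, ?_⟩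
      rintro ⟨a, ha, has⟩
      exact hs (Subtype.ext has ▸ ha)
    obtain ⟨lam, x, hx⟩ := hSs.exists_isPerronPair hne
    obtain ⟨μ, y, hy⟩ := hTs.image_induced.exists_isPerronPair hTne
    -- A proper non-functional `T` would give `1 < μ < lam`, hence a fourth eigenvalue besides `0`,
    -- `1` and `μ`.
    have hlt := hx.lt_of_ssubset hSs hy hTS hTne
    have hS' := Digraph.complementaritySpectrum_eq_of_encard hloop hthree hne hSs hnf hx
    have hT' := Digraph.complementaritySpectrum_eq_of_encard hloop hthree hTne hTs.image_induced
      hTf' hy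
    have hmem : lam ∈ ({0, 1, μ} : Set ℝ) := by
      rw [← hT'.2, hS'.2]; simp
    rcases hmem with h | h | h <;> linarith [hS'.1, show lam = _ from h]
  refine ⟨fun S hS => ?_, ?_, fun S hS T hT hS7 hT7 => ?_⟩
  · by_cases hf : D.IsFunctionalOn S
    · obtain ⟨hne, hSs⟩ := hstrong S hS
      have := hne.to_subtype
      rcases Digraph.isIsolatedVertex_or_isCycle (hloop' S) hSs.induced_univ
        (Digraph.isFunctionalOn_induced_univ_iff.2 hf) with h | h
      · exact Or.inl h
      · exact Or.inr (Or.inl h)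
    · exact Or.inr (Or.inr (hseven S hS hf))
  · by_contra! hno
    have hsub := Digraph.complementaritySpectrum_subset_of_functional (D := D) fun S hS => by
      by_contra hf
      exact hno S hS (hseven S hS hf)
    have h1 := (Set.encard_le_encard hsub).trans (Set.encard_pair zero_ne_one).le
    rw [hthree] at h1
    exact absurd h1 (by norm_num)
  · obtain ⟨hSne, hSs⟩ := hstrong S hS
    obtain ⟨hTne, hTs⟩ := hstrong T hT
    have hSf := mt Digraph.isFunctionalOn_induced_univ_iff.2 hS7.not_functional
    have hTf := mt Digraph.isFunctionalOn_induced_univ_iff.2 hT7.not_functional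
    obtain ⟨lam, x, hx⟩ := hSs.exists_isPerronPair hSne
    obtain ⟨μ, y, hy⟩ := hTs.exists_isPerronPair hTne
    have hS' := Digraph.complementaritySpectrum_eq_of_encard hloop hthree hSne hSs hSf hx
    have hT' := Digraph.complementaritySpectrum_eq_of_encard hloop hthree hTne hTs hTf hy
    have hmem : lam ∈ ({0, 1, μ} : Set ℝ) := by
      rw [← hT'.2, hS'.2]; simp
    have heq : lam = μ := by
      rcases hmem with h | h | h
      · linarith [hS'.1, show lam = _ from h]
      · linarith [hS'.1, show lam = _ from h]
      · exact h
    rw [hx.specRadius_eq hSne, hy.specRadius_eq hTne, heq]
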